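/- Let $s=(s_1,s_2)$ and $\varepsilon=(\varepsilon_1,\varepsilon_2)$ with $s_i,\varepsilon_i\in\{\pm1\}$ and $s_1\neq s_2$; write $s_i=(-1)^{|i|}$ with $|i|\in\{0,1\}$. Let $\mathscr B_{s,\varepsilon}$ be the rank $1$ twisted super Yangian of type AIII: the $\mathbb Z_2$-graded unital associative $\mathbb C$-algebra with generators $b_{ij}^{(r)}$ ($1\le i,j\le 2$, $r\ge 1$) of parity $|i|+|j|$ and defining relations, for $b_{ij}(u)=\delta_{ij}\varepsilon_i+\sum_{r\ge1}b_{ij}^{(r)}u^{-r}$ and $\sigma=(-1)^{|i||j|+|i||k|+|j||k|}$, $$[b_{ij}(u),b_{kl}(v)]=\frac{\sigma}{u-v}\big(b_{kj}(u)b_{il}(v)-b_{kj}(v)b_{il}(u)\big)+\frac{\sigma}{u+v}\Big(\delta_{kj}\sum_{a}b_{ia}(u)b_{al}(v)-\delta_{il}\sum_a b_{ka}(v)b_{aj}(u)\Big)-\frac{\delta_{ij}}{u^2-v^2}\Big(\sum_a b_{ka}(u)b_{al}(v)-\sum_a b_{ka}(v)b_{al}(u)\Big)$$ (the bracket being the supercommutator)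 and $\sum_a b_{ia}(u)b_{aj}(-u)=\delta_{ij}$. Let $\mu_i(u)\in\varepsilon_i+u^{-1}\mathbb C[[u^{-1}]]$, $i=1,2$, and let $M(\mu(u))$ be the Verma module, i.e. the quotient of $\mathscr B_{s,\varepsilon}$ by the left ideal generated by all coefficients of $b_{12}(u)$, $b_{11}(u)-\mu_1(u)$ and $b_{22}(u)-\mu_2(u)$. Assume $M(\mu(u))\neq0$, and let $V(\mu(u))$ be its unique irreducible quotient. Put $$\tilde\mu_1(u)=(2u-s_2)\mu_1(u)+s_2\mu_2(u),\qquad \tilde\mu_2(u)=2u\,\mu_2(u).$$ Then $V(\mu(u))$ is finite-dimensional if and only if there exists a monic polynomial $P(u)\in\mathbb C[u]$ such that, in $\mathbb C((u^{-1}))$, $$\frac{\tilde\mu_1(u)}{\tilde\mu_2(u)}=\varepsilon_1\varepsilon_2(-1)^{\deg P}\,\frac{P(u)}{P(-u+s_2)}.$$ -/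

import Mathlib

namespace TwistedSuperYangian

open scoped PowerSeries LaurentSeries

/-- The parity `|i| ∈ {0, 1}` attached to a sign `s_i = (-1)^{|i|}`. -/
def parity (s : ℤˣ) : ℕ := if s = 1 then 0 else 1

/-- The sign `(-1)^{|i||j| + |i||k| + |j||k|}`. -/
def sgn {κ : ℕ} (s : Fin κ → ℤˣ) (i j k : Fin κ) : ℂ :=
  (-1) ^ (parity (s i) * parity (s j) + parity (s i) * parity (s k)
    + parity (s j) * parity (s k))

/-- The free algebra on the symbols `b_{ij}^{(r)}`, `r ≥ 1`;
the letter `(i, j, r)` stands for `b_{ij}^{(r+1)}`. -/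
abbrev Free (κ : ℕ) : Type := FreeAlgebra ℂ (Fin κ × Fin κ × ℕ)

/-- The coefficient of `u^{-r}` in `b_{ij}(u) = δ_{ij} ε_i + ∑_{r ≥ 1} b_{ij}^{(r)} u^{-r}`,
for an arbitrary integer `r` (it vanishes for negative `r`). -/
def freeCoeff {κ : ℕ} (ε : Fin κ → ℤˣ) (i j : Fin κ) : ℤ → Free κ
  | Int.ofNat 0 => if i = j then algebraMap ℂ (Free κ) ((ε i : ℤ) : ℂ) else 0
  | Int.ofNat (r + 1) => FreeAlgebra.ι ℂ (i, j, r)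
  | Int.negSucc _ => 0

/-- The supercommutator `[b_{ij}^{(r)}, b_{kl}^{(t)}]`, where `b_{ij}^{(r)}` has parity
`|i| + |j|`. -/
def superComm {κ : ℕ} (s ε : Fin κ → ℤˣ) (i j k l : Fin κ) (r t : ℤ) : Free κ :=
  freeCoeff ε i j r * freeCoeff ε k l t
    - ((-1 : ℂ) ^ ((parity (s i) + parity (s j)) * (parity (s k) + parity (s l)))) •
      (freeCoeff ε k l t * freeCoeff ε i j r)

/-- The defining relations of the twisted super Yangian of type AIII.

`reflection` is the coefficient of `u^{-r} v^{-t}` in the relation obtained by clearing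
the denominator `u^2 - v^2`:
`(u^2 - v^2) [b_{ij}(u), b_{kl}(v)]
  = σ (u + v) (b_{kj}(u) b_{il}(v) - b_{kj}(v) b_{il}(u))
  + σ (u - v) (δ_{kj} ∑_a b_{ia}(u) b_{al}(v) - δ_{il} ∑_a b_{ka}(v) b_{aj}(u))
  - δ_{ij} (∑_a b_{ka}(u) b_{al}(v) - ∑_a b_{ka}(v) b_{al}(u))`
with `σ = (-1)^{|i||j| + |i||k| + |j||k|}`.

`unitary` is the coefficient of `u^{-r}` in `∑_a b_{ia}(u) b_{aj}(-u) = δ_{ij}`. -/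
inductive DefRel {κ : ℕ} (s ε : Fin κ → ℤˣ) : Free κ → Free κ → Prop
  | reflection (i j k l : Fin κ) (r t : ℤ) :
      DefRel s ε
        (superComm s ε i j k l (r + 2) t - superComm s ε i j k l r (t + 2))
        (sgn s i j k •
            (freeCoeff ε k j (r + 1) * freeCoeff ε i l t
              + freeCoeff ε k j r * freeCoeff ε i l (t + 1)
              - freeCoeff ε k j t * freeCoeff ε i l (r + 1)
              - freeCoeff ε k j (t + 1) * freeCoeff ε i l r)
          + sgn s i j k •
            ((if k = j then
                ∑ a, (freeCoeff ε i a (r + 1) * freeCoeff ε a l t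
                  - freeCoeff ε i a r * freeCoeff ε a l (t + 1))
              else 0)
            - (if i = l then
                ∑ a, (freeCoeff ε k a t * freeCoeff ε a j (r + 1)
                  - freeCoeff ε k a (t + 1) * freeCoeff ε a j r)
              else 0))
          - (if i = j then
              ∑ a, (freeCoeff ε k a r * freeCoeff ε a l t
                - freeCoeff ε k a t * freeCoeff ε a l r)
            else 0))
  | unitary (i j : Fin κ) (r : ℕ) :
      DefRel s ε
        (∑ a, ∑ p ∈ Finset.HasAntidiagonal.antidiagonal r,
          ((-1 : ℂ) ^ p.2) • (freeCoeff ε i a (p.1 : ℤ) * freeCoeff ε a j (p.2 : ℤ)))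
        (if i = j ∧ r = 0 then 1 else 0)

/-- The twisted super Yangian `𝓑_{s,ε}` of type AIII (its underlying associative algebra:
the `ℤ/2`-grading enters only through the signs in the relations). -/
abbrev Yangian {κ : ℕ} (s ε : Fin κ → ℤˣ) : Type := RingQuot (DefRel s ε)

/-- The element `b_{ij}^{(r)}` of the twisted super Yangian; `b_{ij}^{(0)} = δ_{ij} ε_i`. -/
def b {κ : ℕ} (s ε : Fin κ → ℤˣ) (i j : Fin κ) (r : ℕ) : Yangian s ε :=
  RingQuot.mkAlgHom ℂ (DefRel s ε) (freeCoeff ε i j (r : ℤ))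

/-- The left ideal generated by all coefficients of `b_{ij}(u)`, `i < j`, and of
`b_{ii}(u) - μ_i(u)`. A series in `u^{-1}` is a power series whose variable is `u^{-1}`. -/
def vermaIdeal {κ : ℕ} (s ε : Fin κ → ℤˣ) (μ : Fin κ → ℂ⟦X⟧) :
    Submodule (Yangian s ε) (Yangian s ε) :=
  Submodule.span (Yangian s ε)
    ({x | ∃ (i j : Fin κ) (r : ℕ), i < j ∧ x = b s ε i j r} ∪
      {x | ∃ (i : Fin κ) (r : ℕ),
        x = b s ε i i r - algebraMap ℂ (Yangian s ε) (PowerSeries.coeff r (μ i))})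

/-- The Verma module `M(μ(u))`. It may be zero. -/
abbrev Verma {κ : ℕ} (s ε : Fin κ → ℤˣ) (μ : Fin κ → ℂ⟦X⟧) : Type :=
  Yangian s ε ⧸ vermaIdeal s ε μ

/-- The sum of all proper submodules of `M(μ(u))`. When `M(μ(u)) ≠ 0`, this is the unique
maximal proper submodule. -/
def maxSubmodule {κ : ℕ} (s ε : Fin κ → ℤˣ) (μ : Fin κ → ℂ⟦X⟧) :
    Submodule (Yangian s ε) (Verma s ε μ) :=
  sSup {N | N ≠ ⊤}

/-- The module `V(μ(u))`: for `M(μ(u)) ≠ 0`, the unique irreducible quotient of `M(μ(u))`. -/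
abbrev Irr {κ : ℕ} (s ε : Fin κ → ℤˣ) (μ : Fin κ → ℂ⟦X⟧) : Type :=
  Verma s ε μ ⧸ maxSubmodule s ε μ

/-- The element `u` of the field `ℂ((u⁻¹))`, realised as Laurent series in `X = u⁻¹`. -/
noncomputable def u : ℂ⸨X⸩ := HahnSeries.single (-1 : ℤ) (1 : ℂ)

/-- `ρ_{i+1} = ∑_{a > i} s_a`, as a constant series. -/
noncomputable def rhoSucc {κ : ℕ} (s : Fin κ → ℤˣ) (i : Fin κ) : ℂ⸨X⸩ :=
  ∑ a ∈ Finset.Ioi i, (((s a : ℤˣ) : ℤ) : ℂ⸨X⸩)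

/-- `μ̃_i(u) = (2u - ρ_{i+1}) μ_i(u) + ∑_{a > i} s_a μ_a(u)`. -/
noncomputable def muTilde {κ : ℕ} (s : Fin κ → ℤˣ) (μ : Fin κ → ℂ⟦X⟧) (i : Fin κ) : ℂ⸨X⸩ :=
  (2 * u - rhoSucc s i) * (μ i : ℂ⸨X⸩)
    + ∑ a ∈ Finset.Ioi i, (((s a : ℤˣ) : ℤ) : ℂ⸨X⸩) * (μ a : ℂ⸨X⸩)

end TwistedSuperYangian

/-! Everything is read off from the vectors `b_{21}^{(r)} v`, where `v` is the highest weight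
vector. The reflection relation gives `b_{12}(u) b_{21}^{(r)} v = c_r(u) v` with scalar series
`c_r`, and a two-step recurrence in `r` shows `c_r = p_r(u) μ_1(u) + q_r(u) μ_2(u)` with polynomials
of degree less than `r` (`IsHighest.exists_pairing`, `pairing_eq`). A combination of the
`b_{21}^{(r)} v` dies in the irreducible quotient exactly when the same combination of the `c_r`
vanishes (`linearCombination_mem_maxSubmodule`): a vector of weight one killed by `b_{12}(u)`
generates a proper submodule.

Finite-dimensionality is therefore equivalent to rationality of `μ_1/μ_2`. In a finite-dimensional
quotient the `c_r` satisfy a linear relation, and it is not vacuous because the top coefficients of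
the `p_r` of one parity are nonzero. Conversely, if `D μ_1 = C μ_2`, then `D c_r = e_r μ_2` with
polynomials `e_r`. As `c_r` is a series in `u⁻¹`, `deg e_r ≤ deg D`, so almost all `b_{21}^{(r)} v`
depend on earlier ones. Because `b_{21}` is odd, squares of its coefficients have lower filtration
degree, and finitely many words without repetition span the quotient.

It remains to see that rationality alone forces the form `P(u)/P(s_2 - u)`. Put `G(X) = ∑_r e_r(X)
u^{-r}`, which is a polynomial in `X` since the degrees are bounded. The recurrence presents `(X -
u)(X + u - s_2) G(X)` explicitly, and setting `X = s_2 - u` gives a functional equation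
(`reflection_identity`). With `μ̃_1/μ̃_2 = A/B` it reads `A(u) A(s_2 - u) = B(u) B(s_2 - u)`. After
cancelling the common factor, `B` is a constant times the reflection of `A`
(`exists_monic_of_mul_comp_eq`). Leading terms fix the constant. -/

namespace TwistedSuperYangian

open scoped PowerSeries LaurentSeries

/-! ### Degree filtration, and reordering words up to lower degree -/

section Filtration

variable {κ : ℕ} (s ε : Fin κ → ℤˣ)

/-- The image of `b_{ij}^{(r)}` in the twisted super Yangian, for an arbitrary integer `r`. -/
def coeffB (i j : Fin κ) (r : ℤ) : Yangian s ε :=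
  RingQuot.mkAlgHom ℂ (DefRel s ε) (freeCoeff ε i j r)

/-- The sign in the supercommutator of `b_{ij}` and `b_{kl}`. -/
def commSign (i j k l : Fin κ) : ℂ :=
  (-1) ^ ((parity (s i) + parity (s j)) * (parity (s k) + parity (s l)))

/-- The supercommutator of `b_{ij}^{(r)}` and `b_{kl}^{(t)}` in the twisted super Yangian. -/
def sComm (i j k l : Fin κ) (r t : ℤ) : Yangian s ε :=
  coeffB s ε i j r * coeffB s ε k l t
    - commSign s i j k l • (coeffB s ε k l t * coeffB s ε i j r)

theorem sComm_reflection (i j k l : Fin κ) (r t : ℤ) :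
    sComm s ε i j k l (r + 2) t - sComm s ε i j k l r (t + 2) =
      sgn s i j k •
            (coeffB s ε k j (r + 1) * coeffB s ε i l t
              + coeffB s ε k j r * coeffB s ε i l (t + 1)
              - coeffB s ε k j t * coeffB s ε i l (r + 1)
              - coeffB s ε k j (t + 1) * coeffB s ε i l r)
          + sgn s i j k •
            ((if k = j then
                ∑ a, (coeffB s ε i a (r + 1) * coeffB s ε a l t
                  - coeffB s ε i a r * coeffB s ε a l (t + 1))
              else 0)
            - (if i = l then
                ∑ a, (coeffB s ε k a t * coeffB s ε a j (r + 1)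
                  - coeffB s ε k a (t + 1) * coeffB s ε a j r)
              else 0))
          - (if i = j then
              ∑ a, (coeffB s ε k a r * coeffB s ε a l t
                - coeffB s ε k a t * coeffB s ε a l r)
            else 0) := by
  have h := RingQuot.mkAlgHom_rel ℂ (DefRel.reflection (s := s) (ε := ε) i j k l r t)
  simp only [superComm, map_sub, map_add, map_smul, map_mul, map_sum, map_zero,
    apply_ite (RingQuot.mkAlgHom ℂ (DefRel s ε))] at h
  exact h

theorem coeffB_zero (i j : Fin κ) :
    coeffB s ε i j 0 = if i = j then algebraMap ℂ (Yangian s ε) ((ε i : ℤ) : ℂ) else 0 := by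
  change RingQuot.mkAlgHom ℂ (DefRel s ε) (freeCoeff ε i j (Int.ofNat 0)) = _
  rw [freeCoeff]
  split_ifs
  · exact AlgHom.commutes _ _
  · exact map_zero _

theorem coeffB_of_neg (i j : Fin κ) {r : ℤ} (hr : r < 0) : coeffB s ε i j r = 0 := by
  obtain ⟨n, rfl⟩ := Int.eq_negSucc_of_lt_zero hr
  exact map_zero _

/-- The product of a list of generators; the letter `(i, j, r)` stands for `b_{ij}^{(r+1)}`. -/
def word (l : List (Fin κ × Fin κ × ℕ)) : Yangian s ε :=
  (l.map fun x => coeffB s ε x.1 x.2.1 ((x.2.2 : ℤ) + 1)).prod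

/-- The total degree of a list of generators, `b_{ij}^{(r)}` having degree `r`. -/
def wordDeg (l : List (Fin κ × Fin κ × ℕ)) : ℤ := (l.map fun x => (x.2.2 : ℤ) + 1).sum

/-- The total weight of a list of generators, `b_{ij}^{(r)}` having weight `i - j`. -/
def wordWt (l : List (Fin κ × Fin κ × ℕ)) : ℤ :=
  (l.map fun x => ((x.1 : ℕ) : ℤ) - ((x.2.1 : ℕ) : ℤ)).sum

@[simp] theorem word_nil : word s ε [] = 1 := rfl

@[simp] theorem word_cons (x : Fin κ × Fin κ × ℕ) (l : List (Fin κ × Fin κ × ℕ)) :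
    word s ε (x :: l) = coeffB s ε x.1 x.2.1 ((x.2.2 : ℤ) + 1) * word s ε l := by
  simp [word]

@[simp] theorem word_append (l l' : List (Fin κ × Fin κ × ℕ)) :
    word s ε (l ++ l') = word s ε l * word s ε l' := by
  simp [word]

@[simp] theorem wordDeg_nil : wordDeg ([] : List (Fin κ × Fin κ × ℕ)) = 0 := rfl

@[simp] theorem wordDeg_cons (x : Fin κ × Fin κ × ℕ) (l : List (Fin κ × Fin κ × ℕ)) :
    wordDeg (x :: l) = (x.2.2 : ℤ) + 1 + wordDeg l := by
  simp [wordDeg]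

@[simp] theorem wordDeg_append (l l' : List (Fin κ × Fin κ × ℕ)) :
    wordDeg (l ++ l') = wordDeg l + wordDeg l' := by
  simp [wordDeg]

@[simp] theorem wordWt_nil : wordWt ([] : List (Fin κ × Fin κ × ℕ)) = 0 := rfl

@[simp] theorem wordWt_cons (x : Fin κ × Fin κ × ℕ) (l : List (Fin κ × Fin κ × ℕ)) :
    wordWt (x :: l) = ((x.1 : ℕ) : ℤ) - ((x.2.1 : ℕ) : ℤ) + wordWt l := by
  simp [wordWt]

@[simp] theorem wordWt_append (l l' : List (Fin κ × Fin κ × ℕ)) :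
    wordWt (l ++ l') = wordWt l + wordWt l' := by
  simp [wordWt]

theorem wordDeg_nonneg (l : List (Fin κ × Fin κ × ℕ)) : 0 ≤ wordDeg l := by
  induction l with
  | nil => simp
  | cons x l ih => rw [wordDeg_cons]; omega

theorem wordDeg_perm {l l' : List (Fin κ × Fin κ × ℕ)} (h : l.Perm l') :
    wordDeg l = wordDeg l' := (h.map _).sum_eq

theorem wordWt_perm {l l' : List (Fin κ × Fin κ × ℕ)} (h : l.Perm l') :
    wordWt l = wordWt l' := (h.map _).sum_eq

/-- The span of the words of degree at most `n` and of weight `w`. -/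
def filt (n w : ℤ) : Submodule ℂ (Yangian s ε) :=
  Submodule.span ℂ {x | ∃ l, wordDeg l ≤ n ∧ wordWt l = w ∧ x = word s ε l}

variable {s ε}

theorem word_mem_filt (l : List (Fin κ × Fin κ × ℕ)) {n w : ℤ} (hn : wordDeg l ≤ n)
    (hw : wordWt l = w) : word s ε l ∈ filt s ε n w :=
  Submodule.subset_span ⟨l, hn, hw, rfl⟩

theorem filt_mono {n n' w : ℤ} (h : n ≤ n') : filt s ε n w ≤ filt s ε n' w :=
  Submodule.span_mono fun _ ⟨l, h1, h2, h3⟩ => ⟨l, h1.trans h, h2, h3⟩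

theorem mul_mem_filt {n n' w w' : ℤ} {x y : Yangian s ε} (hx : x ∈ filt s ε n w)
    (hy : y ∈ filt s ε n' w') : x * y ∈ filt s ε (n + n') (w + w') := by
  have h := Submodule.mul_mem_mul hx hy
  rw [filt, filt, Submodule.span_mul_span] at h
  refine Submodule.span_mono ?_ h
  rintro _ ⟨_, ⟨l, h1, h2, rfl⟩, _, ⟨l', h1', h2', rfl⟩, rfl⟩
  exact ⟨l ++ l', by rw [wordDeg_append]; omega, by rw [wordWt_append]; omega, by simp⟩

theorem coeffB_mem_filt (i j : Fin κ) (r : ℤ) :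
    coeffB s ε i j r ∈ filt s ε r (((i : ℕ) : ℤ) - ((j : ℕ) : ℤ)) := by
  rcases lt_trichotomy r 0 with hr | rfl | hr
  · rw [coeffB_of_neg _ _ _ _ hr]; exact zero_mem _
  · rw [coeffB_zero]
    split_ifs with h
    · subst h
      rw [Algebra.algebraMap_eq_smul_one]
      exact Submodule.smul_mem _ _ (word_mem_filt [] (by simp) (by simp))
    · exact zero_mem _
  · obtain ⟨n, rfl⟩ : ∃ n : ℕ, r = (n : ℤ) + 1 := ⟨(r - 1).toNat, by omega⟩
    have := word_mem_filt (s := s) (ε := ε) [(i, j, n)] le_rfl rfl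
    simpa using this

theorem coeffB_mul_mem_filt {n w : ℤ} (i j k l : Fin κ) (r t : ℤ) (hn : r + t ≤ n)
    (hw : ((i : ℕ) : ℤ) - ((j : ℕ) : ℤ) + (((k : ℕ) : ℤ) - ((l : ℕ) : ℤ)) = w) :
    coeffB s ε i j r * coeffB s ε k l t ∈ filt s ε n w :=
  filt_mono hn (hw ▸ mul_mem_filt (coeffB_mem_filt i j r) (coeffB_mem_filt k l t))

theorem commSign_self_left (i k l : Fin κ) : commSign s i i k l = 1 := by
  rw [commSign, ← two_mul, mul_assoc, pow_mul]; simp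

theorem sComm_of_neg (i j k l : Fin κ) {r : ℤ} (hr : r < 0) (t : ℤ) :
    sComm s ε i j k l r t = 0 := by
  simp [sComm, coeffB_of_neg s ε i j hr]

theorem sComm_zero (i j k l : Fin κ) (t : ℤ) : sComm s ε i j k l 0 t = 0 := by
  rw [sComm, coeffB_zero]
  split_ifs with h
  · subst h
    rw [commSign_self_left, one_smul, Algebra.commutes, sub_self]
  · simp

/-- The reflection relation moves two units of degree from the first argument to the second at the
cost of products of total degree `r + t - 1`. Repeating this brings the first index down to `0` or
below, where the coefficient is a scalar or zero and the supercommutator vanishes. -/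
theorem sComm_mem_filt (i j k l : Fin κ) (r t : ℤ) :
    sComm s ε i j k l r t ∈ filt s ε (r + t - 1)
      (((i : ℕ) : ℤ) - ((j : ℕ) : ℤ) + (((k : ℕ) : ℤ) - ((l : ℕ) : ℤ))) := by
  have key : ∀ n : ℕ, ∀ r t : ℤ, r ≤ n → sComm s ε i j k l r t ∈ filt s ε (r + t - 1)
      (((i : ℕ) : ℤ) - ((j : ℕ) : ℤ) + (((k : ℕ) : ℤ) - ((l : ℕ) : ℤ))) := by
    intro n
    induction n with
    | zero =>
      intro r t hr
      rcases lt_or_eq_of_le hr with h | h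
      · rw [sComm_of_neg _ _ _ _ (by simpa using h)]; exact zero_mem _
      · rw [h, Nat.cast_zero, sComm_zero]; exact zero_mem _
    | succ n ih =>
      intro r t hr
      obtain ⟨r, rfl⟩ : ∃ r', r = r' + 2 := ⟨r - 2, by ring⟩
      have h1 := sComm_reflection s ε i j k l r t
      rw [sub_eq_iff_eq_add] at h1
      rw [h1]
      have h2 := ih r (t + 2) (by push_cast at hr; omega)
      refine add_mem (sub_mem (add_mem (Submodule.smul_mem _ _ ?_) (Submodule.smul_mem _ _ ?_)) ?_)
        (filt_mono (by omega) h2)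
      · refine sub_mem (sub_mem (add_mem ?_ ?_) ?_) ?_ <;>
          exact coeffB_mul_mem_filt _ _ _ _ _ _ (by omega) (by omega)
      · refine sub_mem ?_ ?_
        · split_ifs with h
          · subst h
            refine sum_mem fun a _ => sub_mem ?_ ?_ <;>
              exact coeffB_mul_mem_filt _ _ _ _ _ _ (by omega) (by omega)
          · exact zero_mem _
        · split_ifs with h
          · subst h
            refine sum_mem fun a _ => sub_mem ?_ ?_ <;>
              exact coeffB_mul_mem_filt _ _ _ _ _ _ (by omega) (by omega)
          · exact zero_mem _
      · split_ifs with h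
        · subst h
          refine sum_mem fun a _ => sub_mem ?_ ?_ <;>
            exact coeffB_mul_mem_filt _ _ _ _ _ _ (by omega) (by omega)
        · exact zero_mem _
  exact key r.toNat r t (Int.self_le_toNat r)

/-- The associated graded algebra is supercommutative; `c` collects the signs of the transpositions.
-/
theorem word_perm {l l' : List (Fin κ × Fin κ × ℕ)} (h : l.Perm l') :
    ∃ c : ℂ, word s ε l - c • word s ε l' ∈ filt s ε (wordDeg l - 1) (wordWt l) := by
  induction h with
  | nil => exact ⟨1, by simp⟩
  | @cons x l l' h ih =>
    obtain ⟨c, hc⟩ := ih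
    refine ⟨c, ?_⟩
    have := mul_mem_filt (coeffB_mem_filt (s := s) (ε := ε) x.1 x.2.1 ((x.2.2 : ℤ) + 1)) hc
    rw [word_cons, word_cons, ← mul_smul_comm, ← mul_sub, wordDeg_cons, wordWt_cons, add_sub_assoc]
    exact this
  | swap x y l =>
    refine ⟨commSign s y.1 y.2.1 x.1 x.2.1, ?_⟩
    have h1 := sComm_mem_filt (s := s) (ε := ε) y.1 y.2.1 x.1 x.2.1
      ((y.2.2 : ℤ) + 1) ((x.2.2 : ℤ) + 1)
    have h2 := mul_mem_filt h1 (word_mem_filt l le_rfl rfl)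
    rw [sComm, sub_mul, smul_mul_assoc, mul_assoc, mul_assoc] at h2
    simp only [word_cons, wordDeg_cons, wordWt_cons]
    convert h2 using 2 <;> ring
  | @trans l l' l'' h h' ih ih' =>
    obtain ⟨c, hc⟩ := ih
    obtain ⟨c', hc'⟩ := ih'
    refine ⟨c * c', ?_⟩
    rw [← wordDeg_perm h, ← wordWt_perm h] at hc'
    have := add_mem hc (Submodule.smul_mem _ c hc')
    rwa [smul_sub, smul_smul, sub_add_sub_cancel] at this

theorem smul_mem_of_mem_filt {N : Type*} [AddCommGroup N] [Module ℂ N] [Module (Yangian s ε) N]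
    [IsScalarTower ℂ (Yangian s ε) N] (T : Submodule ℂ N) (v : N) {n w : ℤ}
    (H : ∀ l, wordWt l = w → wordDeg l ≤ n → word s ε l • v ∈ T)
    {x : Yangian s ε} (hx : x ∈ filt s ε n w) : x • v ∈ T := by
  induction hx using Submodule.span_induction with
  | mem x hx => obtain ⟨l, h1, h2, rfl⟩ := hx; exact H l h2 h1
  | zero => rw [zero_smul]; exact zero_mem _
  | add x y _ _ hx hy => rw [add_smul]; exact add_mem hx hy
  | smul c x _ hx => rw [smul_assoc]; exact T.smul_mem _ hx

/-- To place all the vectors `word l • v` of a given weight in a subspace, one may permute each word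
and use words of lower degree. -/
theorem word_smul_mem {N : Type*} [AddCommGroup N] [Module ℂ N] [Module (Yangian s ε) N]
    [IsScalarTower ℂ (Yangian s ε) N] (T : Submodule ℂ N) (v : N) (w : ℤ)
    (H : ∀ l, wordWt l = w →
      (∀ x ∈ filt s ε (wordDeg l - 1) w, x • v ∈ T) →
      ∃ l', l.Perm l' ∧ word s ε l' • v ∈ T) (l : List (Fin κ × Fin κ × ℕ))
    (hl : wordWt l = w) : word s ε l • v ∈ T := by
  have key : ∀ n : ℕ, ∀ l, wordDeg l < n → wordWt l = w → word s ε l • v ∈ T := by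
    intro n
    induction n with
    | zero =>
      intro l hl
      have := wordDeg_nonneg l
      simp at hl
      omega
    | succ n ih =>
      intro l hl hw
      have h1 : ∀ x ∈ filt s ε (wordDeg l - 1) w, x • v ∈ T := fun x hx =>
        smul_mem_of_mem_filt T v (fun l' h1 h2 => ih l' (by push_cast at hl; omega) h1) hx
      obtain ⟨l', hp, hl'⟩ := H l hw h1
      obtain ⟨c, hc⟩ := word_perm (s := s) (ε := ε) hp
      have h2 := add_mem (h1 _ (hw ▸ hc)) (T.smul_mem c hl')
      rwa [sub_smul, smul_assoc, sub_add_cancel] at h2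
  exact key (wordDeg l + 1).toNat l (by have := wordDeg_nonneg l; omega) hl

end Filtration

/-! ### The weight grading by `b_{11}^{(1)}` -/

section Weights

theorem sgn_diag {κ : ℕ} (s : Fin κ → ℤˣ) (i k : Fin κ) : sgn s i i k = ((s i : ℤ) : ℂ) := by
  rcases Int.units_eq_one_or (s i) with h | h <;>
    rcases Int.units_eq_one_or (s k) with h' | h' <;> simp [sgn, parity, h, h', pow_succ]

theorem sgn_diag_right {κ : ℕ} (s : Fin κ → ℤˣ) (i k : Fin κ) :
    sgn s i k k = ((s k : ℤ) : ℂ) := by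
  rcases Int.units_eq_one_or (s i) with h | h <;>
    rcases Int.units_eq_one_or (s k) with h' | h' <;> simp [sgn, parity, h, h', pow_succ]

theorem unit_cast_ne_zero (e : ℤˣ) : ((e : ℤ) : ℂ) ≠ 0 := by
  rcases Int.units_eq_one_or e with h | h <;> simp [h]

theorem unit_cast_mul_self (e : ℤˣ) : ((e : ℤ) : ℂ) * ((e : ℤ) : ℂ) = 1 := by
  rcases Int.units_eq_one_or e with h | h <;> simp [h]

variable (s ε : Fin 2 → ℤˣ)

/-- The factor by which `b_{11}^{(1)}` measures weights. -/
noncomputable def weightStep : ℂ := -2 * ((s 0 : ℤ) : ℂ) * ((ε 0 : ℤ) : ℂ)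

theorem weightStep_ne_zero : weightStep s ε ≠ 0 :=
  mul_ne_zero (mul_ne_zero (by norm_num) (unit_cast_ne_zero _)) (unit_cast_ne_zero _)

/-- Reflection at `r = -1`: the second supercommutator and every term with a negative index drop
out, and the remaining coefficients of index `0` are scalars. -/
theorem cartan_mul_coeffB (k l : Fin 2) (t : ℤ) :
    coeffB s ε 0 0 1 * coeffB s ε k l t = coeffB s ε k l t * coeffB s ε 0 0 1 +
      (weightStep s ε * ((((k : ℕ) : ℤ) - ((l : ℕ) : ℤ) : ℤ) : ℂ)) • coeffB s ε k l t := by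
  have h := sComm_reflection s ε 0 0 k l (-1) t
  rw [sComm_of_neg 0 0 k l (r := -1) (by norm_num), sub_zero, sComm, commSign_self_left, one_smul,
    sub_eq_iff_eq_add] at h
  have e : (-1 + 2 : ℤ) = 1 := by norm_num
  rw [e] at h
  rw [h, sgn_diag, add_comm]
  congr 1
  have e' : (-1 + 1 : ℤ) = 0 := by norm_num
  simp only [e', coeffB_of_neg s ε _ _ (show (-1 : ℤ) < 0 by norm_num), coeffB_zero,
    Fin.sum_univ_two, Algebra.algebraMap_eq_smul_one, weightStep]
  fin_cases k <;> fin_cases l <;>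
    simp [smul_smul] <;> module

theorem cartan_mul_word (l : List (Fin 2 × Fin 2 × ℕ)) :
    coeffB s ε 0 0 1 * word s ε l = word s ε l * coeffB s ε 0 0 1 +
      (weightStep s ε * (wordWt l : ℂ)) • word s ε l := by
  induction l with
  | nil => simp
  | cons x l ih =>
    rw [word_cons, ← mul_assoc, cartan_mul_coeffB, add_mul, mul_assoc, ih, wordWt_cons,
      smul_mul_assoc, mul_add, mul_smul_comm, mul_assoc]
    push_cast
    module

variable {s ε} {N : Type*} [AddCommGroup N] [Module ℂ N] [Module (Yangian s ε) N]
    [IsScalarTower ℂ (Yangian s ε) N]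

theorem cartan_smul_word_smul (l : List (Fin 2 × Fin 2 × ℕ)) {v : N} {a : ℂ}
    (hv : coeffB s ε 0 0 1 • v = a • v) :
    coeffB s ε 0 0 1 • word s ε l • v = (a + weightStep s ε * (wordWt l : ℂ)) • word s ε l • v := by
  rw [smul_smul, cartan_mul_word, add_smul, mul_smul, hv, smul_assoc, add_smul,
    ← algebraMap_smul (Yangian s ε) a v, smul_smul, ← Algebra.commutes, mul_smul, algebraMap_smul]

/-- The sum of the generalized eigenspaces of `b_{11}^{(1)}` for eigenvalues different from `a`. -/
def awayFrom (s ε : Fin 2 → ℤˣ) (N : Type*) [AddCommGroup N] [Module ℂ N] [Module (Yangian s ε) N]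
    [IsScalarTower ℂ (Yangian s ε) N] (a : ℂ) : Submodule ℂ N where
  carrier := {y | ∃ p : Polynomial ℂ, p.eval a ≠ 0 ∧
    Polynomial.aeval (coeffB s ε 0 0 1) p • y = 0}
  zero_mem' := ⟨1, by simp, smul_zero _⟩
  add_mem' := by
    rintro y z ⟨p, hp, hy⟩ ⟨q, hq, hz⟩
    refine ⟨p * q, by simp [hp, hq], ?_⟩
    rw [smul_add]
    nth_rw 1 [mul_comm p q]
    rw [map_mul, map_mul, mul_smul, mul_smul, hy, hz, smul_zero, smul_zero, add_zero]
  smul_mem' := by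
    rintro c y ⟨p, hp, hy⟩
    refine ⟨p, hp, ?_⟩
    rw [← algebraMap_smul (Yangian s ε) c y, smul_smul, ← Algebra.commutes, mul_smul, hy, smul_zero]

theorem aeval_cartan_smul {v : N} {a : ℂ} (hv : coeffB s ε 0 0 1 • v = a • v)
    (p : Polynomial ℂ) : Polynomial.aeval (coeffB s ε 0 0 1) p • v = p.eval a • v := by
  induction p using Polynomial.induction_on' with
  | add p q hp hq => rw [map_add, add_smul, hp, hq, Polynomial.eval_add, add_smul]
  | monomial n c =>
    rw [Polynomial.aeval_monomial, Polynomial.eval_monomial, mul_smul, mul_smul, algebraMap_smul]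
    congr 1
    induction n with
    | zero => simp
    | succ n ih =>
      rw [pow_succ, mul_smul, hv, ← algebraMap_smul (Yangian s ε) a v, smul_smul,
        ← Algebra.commutes, mul_smul, ih, algebraMap_smul, smul_smul, pow_succ']

theorem eigenvector_mem_awayFrom {v : N} {a a' : ℂ} (hv : coeffB s ε 0 0 1 • v = a' • v)
    (h : a' ≠ a) : v ∈ awayFrom s ε N a := by
  refine ⟨Polynomial.X - Polynomial.C a', ?_, ?_⟩
  · simpa [sub_eq_zero] using h.symm
  · rw [aeval_cartan_smul hv]; simp

theorem not_mem_awayFrom {v : N} {a : ℂ} (hv : coeffB s ε 0 0 1 • v = a • v) (h0 : v ≠ 0) :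
    v ∉ awayFrom s ε N a := by
  rintro ⟨p, hp, h⟩
  rw [aeval_cartan_smul hv] at h
  exact (smul_ne_zero hp h0) h

theorem word_smul_mem_awayFrom {v : N} {a a' : ℂ} (hv : coeffB s ε 0 0 1 • v = a' • v)
    (l : List (Fin 2 × Fin 2 × ℕ)) (h : a' + weightStep s ε * (wordWt l : ℂ) ≠ a) :
    word s ε l • v ∈ awayFrom s ε N a :=
  eigenvector_mem_awayFrom (cartan_smul_word_smul l hv) h

/-- A submodule containing a vector outside the other eigenspaces contains the highest weight
vector. -/
theorem mem_of_sub_mem_awayFrom (K : Submodule (Yangian s ε) N) {v y : N} {a c : ℂ}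
    (hv : coeffB s ε 0 0 1 • v = a • v) (hc : c ≠ 0) (hy : y ∈ awayFrom s ε N a)
    (h : c • v + y ∈ K) : v ∈ K := by
  obtain ⟨p, hp, hpy⟩ := hy
  have h1 := K.smul_mem (Polynomial.aeval (coeffB s ε 0 0 1) p) h
  rw [smul_add, hpy, add_zero, ← algebraMap_smul (Yangian s ε) c v, smul_smul,
    ← Algebra.commutes, mul_smul, aeval_cartan_smul hv, algebraMap_smul, smul_smul] at h1
  have h2 := K.smul_mem (algebraMap ℂ (Yangian s ε) (c * p.eval a)⁻¹) h1
  rwa [algebraMap_smul, smul_smul, inv_mul_cancel₀ (mul_ne_zero hc hp), one_smul] at h2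

variable (s ε) in
theorem span_word_eq_top :
    Submodule.span ℂ (Set.range (word s ε : List (Fin 2 × Fin 2 × ℕ) → Yangian s ε)) = ⊤ := by
  rw [eq_top_iff]
  rintro x -
  obtain ⟨x, rfl⟩ := RingQuot.mkAlgHom_surjective ℂ (DefRel s ε) x
  induction x using FreeAlgebra.induction with
  | grade0 c =>
    rw [AlgHom.commutes, Algebra.algebraMap_eq_smul_one]
    exact Submodule.smul_mem _ _ (Submodule.subset_span ⟨[], rfl⟩)
  | grade1 x =>
    refine Submodule.subset_span ⟨[x], ?_⟩
    rw [word_cons, word_nil, mul_one]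
    rfl
  | mul x y hx hy =>
    rw [map_mul]
    have h := Submodule.mul_mem_mul hx hy
    rw [Submodule.span_mul_span] at h
    refine Submodule.span_mono ?_ h
    rintro _ ⟨_, ⟨l, rfl⟩, _, ⟨l', rfl⟩, rfl⟩
    exact ⟨l ++ l', word_append _ _ _ _⟩
  | add x y hx hy => rw [map_add]; exact add_mem hx hy

/-- A complex subspace containing all `word l • v` contains the submodule generated by `v`. -/
theorem smul_mem_of_word_smul_mem (T : Submodule ℂ N) (v : N)
    (H : ∀ l, word s ε l • v ∈ T) (x : Yangian s ε) : x • v ∈ T := by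
  have hx : x ∈ Submodule.span ℂ (Set.range (word s ε : List (Fin 2 × Fin 2 × ℕ) → Yangian s ε)) :=
    span_word_eq_top s ε ▸ Submodule.mem_top
  induction hx using Submodule.span_induction with
  | mem x hx => obtain ⟨l, rfl⟩ := hx; exact H l
  | zero => rw [zero_smul]; exact zero_mem _
  | add x y _ _ hx hy => rw [add_smul]; exact add_mem hx hy
  | smul c x _ hx => rw [smul_assoc]; exact T.smul_mem _ hx

end Weights

/-! ### Highest weight vectors and singular vectors of weight one -/

section HighestWeight

theorem word_append_singleton_smul {s ε : Fin 2 → ℤˣ} {N : Type*} [AddCommGroup N]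
    [Module (Yangian s ε) N] (l : List (Fin 2 × Fin 2 × ℕ)) (x : Fin 2 × Fin 2 × ℕ) (v : N) :
    word s ε (l ++ [x]) • v = word s ε l • coeffB s ε x.1 x.2.1 ((x.2.2 : ℤ) + 1) • v := by
  rw [word_append, word_cons, word_nil, mul_one, mul_smul]

variable {s ε : Fin 2 → ℤˣ} {N : Type*} [AddCommGroup N] [Module ℂ N] [Module (Yangian s ε) N]
    [IsScalarTower ℂ (Yangian s ε) N]

/-- `v` is annihilated by `b_{12}(u)` and is an eigenvector of `b_{ii}(u)` with
eigenvalue `μ_i(u)`. -/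
structure IsHighest (s ε : Fin 2 → ℤˣ) (μ : Fin 2 → ℂ⟦X⟧) {N : Type*} [AddCommGroup N]
    [Module ℂ N] [Module (Yangian s ε) N] (v : N) : Prop where
  raise : ∀ r : ℤ, coeffB s ε 0 1 r • v = 0
  diag : ∀ (i : Fin 2) (r : ℤ), coeffB s ε i i r • v = (μ i : ℂ⸨X⸩).coeff r • v

theorem exists_perm_append_singleton {α : Type*} {l : List α} {x : α} (h : x ∈ l) :
    ∃ l', l.Perm (l' ++ [x]) := by
  obtain ⟨l₁, l₂, rfl⟩ := List.append_of_mem h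
  exact ⟨l₁ ++ l₂, by simpa using (List.perm_middle.trans (List.perm_append_singleton x _).symm)⟩

theorem smul_comm_complex (x : Yangian s ε) (c : ℂ) (v : N) : x • c • v = c • x • v := by
  rw [← algebraMap_smul (Yangian s ε) c v, smul_smul, ← Algebra.commutes, mul_smul, algebraMap_smul]

variable {μ : Fin 2 → ℂ⟦X⟧} {v : N}

/-- A letter different from `b_{21}^{(r)}` may be moved to the right and absorbed by the highest
weight vector. -/
theorem IsHighest.exists_perm_word_smul_mem (hv : IsHighest s ε μ v) (T : Submodule ℂ N)
    {l : List (Fin 2 × Fin 2 × ℕ)} {x : Fin 2 × Fin 2 × ℕ} (hx : x ∈ l)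
    (hx' : ¬ (x.1 = 1 ∧ x.2.1 = 0))
    (H : ∀ y ∈ filt s ε (wordDeg l - 1) (wordWt l), y • v ∈ T) :
    ∃ l', l.Perm l' ∧ word s ε l' • v ∈ T := by
  obtain ⟨l', hl'⟩ := exists_perm_append_singleton hx
  refine ⟨_, hl', ?_⟩
  rw [word_append_singleton_smul]
  obtain ⟨i, j, r⟩ := x
  by_cases hij : i = j
  · subst hij
    rw [hv.diag, smul_comm_complex]
    refine T.smul_mem _ (H _ (word_mem_filt _ ?_ ?_))
    · rw [wordDeg_perm hl', wordDeg_append, wordDeg_cons, wordDeg_nil]; omega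
    · rw [wordWt_perm hl', wordWt_append, wordWt_cons, wordWt_nil]; simp
  · have h0 : i = 0 ∧ j = 1 := by
      simp only at hx'
      omega
    rw [h0.1, h0.2, hv.raise, smul_zero]
    exact zero_mem _

theorem wordWt_eq_length {l : List (Fin 2 × Fin 2 × ℕ)} (h : ∀ x ∈ l, x.1 = 1 ∧ x.2.1 = 0) :
    wordWt l = l.length := by
  induction l with
  | nil => simp
  | cons x l ih =>
    have h1 := h x (by simp)
    rw [wordWt_cons, ih fun y hy => h y (by simp [hy]), h1.1, h1.2]
    simp
    ring

theorem wordWt_nonneg {l : List (Fin 2 × Fin 2 × ℕ)} (h : ∀ x ∈ l, ¬ (x.1 = 0 ∧ x.2.1 = 1)) :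
    0 ≤ wordWt l := by
  induction l with
  | nil => simp
  | cons x l ih =>
    have h1 := h x (by simp)
    have h2 := ih fun y hy => h y (by simp [hy])
    rw [wordWt_cons]
    omega

/-- A word made only of letters `b_{21}` has weight equal to its length, so in weight zero it is
empty. Any other word has a letter that `v` absorbs, and induction on degree applies. -/
theorem IsHighest.word_smul_mem_span (hv : IsHighest s ε μ v) {l : List (Fin 2 × Fin 2 × ℕ)}
    (hl : wordWt l = 0) : word s ε l • v ∈ Submodule.span ℂ {v} := by
  refine word_smul_mem _ v 0 (fun l hl H => ?_) l hl
  by_cases h : ∀ x ∈ l, x.1 = 1 ∧ x.2.1 = 0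
  · rw [wordWt_eq_length h] at hl
    obtain rfl : l = [] := List.length_eq_zero_iff.mp (by exact_mod_cast hl)
    exact ⟨[], List.Perm.refl _, by simp⟩
  · push Not at h
    obtain ⟨x, hx, hx'⟩ := h
    exact hv.exists_perm_word_smul_mem _ hx (fun h => hx' h.1 h.2) (by rwa [hl])

theorem IsHighest.smul_mem_sup (hv : IsHighest s ε μ v) (x : Yangian s ε) :
    x • v ∈ Submodule.span ℂ {v} ⊔ awayFrom s ε N ((μ 0 : ℂ⸨X⸩).coeff 1) := by
  refine smul_mem_of_word_smul_mem _ v (fun l => ?_) x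
  by_cases hl : wordWt l = 0
  · exact Submodule.mem_sup_left (hv.word_smul_mem_span hl)
  · refine Submodule.mem_sup_right (word_smul_mem_awayFrom (hv.diag 0 1) l ?_)
    simpa using ⟨weightStep_ne_zero s ε, hl⟩

/-- The submodule generated by a singular vector of weight one avoids the highest weight. -/
theorem smul_mem_awayFrom_of_singular {w : N} {a : ℂ}
    (hw : coeffB s ε 0 0 1 • w = (a + weightStep s ε) • w)
    (h0 : ∀ r : ℤ, coeffB s ε 0 1 r • w = 0) (x : Yangian s ε) :
    x • w ∈ awayFrom s ε N a := by
  refine smul_mem_of_word_smul_mem _ w (fun l => ?_) x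
  by_cases hl : wordWt l = -1
  -- Only weight `-1` could lead back to the eigenvalue `a`. Such a word contains some `b_{12}`,
  -- which kills `w` once moved to the right.
  · have h1 : word s ε l • w ∈ (⊥ : Submodule ℂ N) := by
      refine word_smul_mem _ w (-1) (fun l hl _ => ?_) l hl
      have h2 : ¬ ∀ x ∈ l, ¬ (x.1 = 0 ∧ x.2.1 = 1) := fun h => by
        have := wordWt_nonneg h
        omega
      push Not at h2
      obtain ⟨x, hx, hx'⟩ := h2
      obtain ⟨l', hl'⟩ := exists_perm_append_singleton hx
      refine ⟨_, hl', ?_⟩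
      rw [word_append_singleton_smul, hx'.1, hx'.2, h0, smul_zero]
      exact zero_mem _
    rw [(Submodule.mem_bot ℂ).mp h1]
    exact zero_mem _
  · refine word_smul_mem_awayFrom hw l fun h => hl ?_
    have h2 : weightStep s ε * ((wordWt l : ℂ) + 1) = 0 := by linear_combination h
    have h3 := (mul_eq_zero.mp h2).resolve_left (weightStep_ne_zero s ε)
    have h4 : ((wordWt l + 1 : ℤ) : ℂ) = 0 := by push_cast; exact h3
    have := Int.cast_eq_zero.mp h4
    omega

end HighestWeight

/-! ### Proper submodules of the Verma module -/

section Verma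

variable (s ε : Fin 2 → ℤˣ) (μ : Fin 2 → ℂ⟦X⟧)

/-- The highest weight vector of the Verma module. -/
def vermaVec : Verma s ε μ := Submodule.Quotient.mk 1

theorem mk_eq_smul_vermaVec (x : Yangian s ε) :
    (Submodule.Quotient.mk x : Verma s ε μ) = x • vermaVec s ε μ := by
  rw [vermaVec, ← Submodule.Quotient.mk_smul, smul_eq_mul, mul_one]

theorem exists_smul_vermaVec (y : Verma s ε μ) : ∃ x : Yangian s ε, y = x • vermaVec s ε μ := by
  obtain ⟨x, rfl⟩ := Submodule.Quotient.mk_surjective _ y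
  exact ⟨x, mk_eq_smul_vermaVec s ε μ x⟩

theorem isHighest_vermaVec : IsHighest s ε μ (vermaVec s ε μ) where
  raise r := by
    rcases lt_or_ge r 0 with hr | hr
    · rw [coeffB_of_neg _ _ _ _ hr, zero_smul]
    · lift r to ℕ using hr
      rw [← mk_eq_smul_vermaVec, Submodule.Quotient.mk_eq_zero]
      exact Submodule.subset_span (Or.inl ⟨0, 1, r, by decide, rfl⟩)
  diag i r := by
    rcases lt_or_ge r 0 with hr | hr
    · rw [coeffB_of_neg _ _ _ _ hr, zero_smul, PowerSeries.coeff_coe, if_pos hr]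
      exact (zero_smul ℂ (vermaVec s ε μ)).symm
    · lift r to ℕ using hr
      rw [LaurentSeries.coeff_coe_powerSeries, ← algebraMap_smul (Yangian s ε),
        ← sub_eq_zero, ← sub_smul, ← mk_eq_smul_vermaVec, Submodule.Quotient.mk_eq_zero]
      exact Submodule.subset_span (Or.inr ⟨i, r, rfl⟩)

variable {s ε μ}

/-- An element with a nonzero component along the generator would let a polynomial in `b_{11}^{(1)}`
extract the generator itself. The bound is a linear subspace, so it passes to the sum of all proper
submodules. -/
theorem le_awayFrom_of_ne_top {K : Submodule (Yangian s ε) (Verma s ε μ)} (hK : K ≠ ⊤)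
    {y : Verma s ε μ} (hy : y ∈ K) :
    y ∈ awayFrom s ε (Verma s ε μ) ((μ 0 : ℂ⸨X⸩).coeff 1) := by
  have hv := isHighest_vermaVec s ε μ
  obtain ⟨x, rfl⟩ := exists_smul_vermaVec s ε μ y
  obtain ⟨a, ha, z, hz, h⟩ := Submodule.mem_sup.mp (hv.smul_mem_sup x)
  obtain ⟨c, rfl⟩ := Submodule.mem_span_singleton.mp ha
  rw [← h] at hy ⊢
  rcases eq_or_ne c 0 with rfl | hc
  · have h0 : (0 : ℂ) • vermaVec s ε μ = 0 := zero_smul ℂ (vermaVec s ε μ)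
    rwa [h0, zero_add]
  · refine absurd ?_ hK
    have h1 := mem_of_sub_mem_awayFrom K (hv.diag 0 1) hc hz hy
    rw [eq_top_iff]
    rintro y -
    obtain ⟨x, rfl⟩ := exists_smul_vermaVec s ε μ y
    exact K.smul_mem x h1

theorem mem_awayFrom_of_mem_maxSubmodule {y : Verma s ε μ} (hy : y ∈ maxSubmodule s ε μ) :
    y ∈ awayFrom s ε (Verma s ε μ) ((μ 0 : ℂ⸨X⸩).coeff 1) := by
  rw [maxSubmodule, sSup_eq_iSup'] at hy
  induction hy using Submodule.iSup_induction' with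
  | mem i x hx => exact le_awayFrom_of_ne_top i.2 hx
  | zero => exact zero_mem _
  | add x y _ _ hx hy => exact add_mem hx hy

theorem vermaVec_ne_zero [Nontrivial (Verma s ε μ)] : vermaVec s ε μ ≠ 0 := fun h => by
  obtain ⟨y, hy⟩ := exists_ne (0 : Verma s ε μ)
  obtain ⟨x, rfl⟩ := exists_smul_vermaVec s ε μ y
  rw [h, smul_zero] at hy
  exact hy rfl

theorem vermaVec_not_mem_maxSubmodule [Nontrivial (Verma s ε μ)] :
    vermaVec s ε μ ∉ maxSubmodule s ε μ := fun h =>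
  not_mem_awayFrom ((isHighest_vermaVec s ε μ).diag 0 1) vermaVec_ne_zero
    (mem_awayFrom_of_mem_maxSubmodule h)

/-- Singular vectors of weight one vanish in the irreducible quotient. -/
theorem mem_maxSubmodule_of_singular [Nontrivial (Verma s ε μ)] {w : Verma s ε μ}
    (hw : coeffB s ε 0 0 1 • w = ((μ 0 : ℂ⸨X⸩).coeff 1 + weightStep s ε) • w)
    (h0 : ∀ r : ℤ, coeffB s ε 0 1 r • w = 0) : w ∈ maxSubmodule s ε μ := by
  refine Submodule.mem_sSup_of_mem (s := Submodule.span (Yangian s ε) {w}) ?_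
    (Submodule.mem_span_singleton_self w)
  intro h
  have h1 : vermaVec s ε μ ∈ Submodule.span (Yangian s ε) {w} := h ▸ Submodule.mem_top
  obtain ⟨x, hx⟩ := Submodule.mem_span_singleton.mp h1
  refine not_mem_awayFrom ((isHighest_vermaVec s ε μ).diag 0 1) vermaVec_ne_zero ?_
  rw [← hx]
  exact smul_mem_awayFrom_of_singular hw h0 x

end Verma

/-! ### The scalars by which `b_{12}(u) b_{21}^{(r)}` acts on a highest weight vector -/

section Pairing

variable {s ε : Fin 2 → ℤˣ} {N : Type*} [AddCommGroup N] [Module ℂ N] [Module (Yangian s ε) N]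
    [IsScalarTower ℂ (Yangian s ε) N] {μ : Fin 2 → ℂ⟦X⟧} {v : N}

theorem coeff_coe_of_neg (f : ℂ⟦X⟧) {r : ℤ} (hr : r < 0) : (f : ℂ⸨X⸩).coeff r = 0 := by
  rw [PowerSeries.coeff_coe, if_pos hr]

theorem coeff_u_mul (x : ℂ⸨X⸩) (t : ℤ) : (u * x).coeff t = x.coeff (t + 1) := by
  rw [u, HahnSeries.coeff_single_mul, one_mul, sub_neg_eq_add]

/-- In the relation for `b_{12}` and `b_{21}` both Kronecker terms survive. Since `b_{12}` kills
`v`, only diagonal products and products `b_{12} b_{21}` remain. -/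
theorem IsHighest.raise_lower (hv : IsHighest s ε μ v) (t r : ℤ) :
    coeffB s ε 0 1 (t + 2) • coeffB s ε 1 0 r • v
        - coeffB s ε 0 1 t • coeffB s ε 1 0 (r + 2) • v =
      ((s 1 : ℤ) : ℂ) •
        (((μ 1 : ℂ⸨X⸩).coeff (t + 1) * (μ 0 : ℂ⸨X⸩).coeff r
          + (μ 1 : ℂ⸨X⸩).coeff t * (μ 0 : ℂ⸨X⸩).coeff (r + 1)
          - (μ 1 : ℂ⸨X⸩).coeff r * (μ 0 : ℂ⸨X⸩).coeff (t + 1)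
          - (μ 1 : ℂ⸨X⸩).coeff (r + 1) * (μ 0 : ℂ⸨X⸩).coeff t
          + (μ 0 : ℂ⸨X⸩).coeff (t + 1) * (μ 0 : ℂ⸨X⸩).coeff r
          - (μ 0 : ℂ⸨X⸩).coeff t * (μ 0 : ℂ⸨X⸩).coeff (r + 1)
          - (μ 1 : ℂ⸨X⸩).coeff r * (μ 1 : ℂ⸨X⸩).coeff (t + 1)
          + (μ 1 : ℂ⸨X⸩).coeff (r + 1) * (μ 1 : ℂ⸨X⸩).coeff t) • v
          + coeffB s ε 0 1 (t + 1) • coeffB s ε 1 0 r • v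
          - coeffB s ε 0 1 t • coeffB s ε 1 0 (r + 1) • v) := by
  have h := congrArg (· • v) (sComm_reflection s ε 0 1 1 0 t r)
  simp only [sComm, sgn_diag_right, if_true, Fin.sum_univ_two, sub_smul, add_smul, smul_assoc,
    mul_smul, hv.raise, hv.diag, smul_zero, sub_zero, smul_comm_complex,
    show ((0 : Fin 2) = 1) = False by simp, if_false] at h
  generalize coeffB s ε 0 1 (t + 2) • coeffB s ε 1 0 r • v = x₁ at h ⊢
  generalize coeffB s ε 0 1 t • coeffB s ε 1 0 (r + 2) • v = x₂ at h ⊢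
  generalize coeffB s ε 0 1 (t + 1) • coeffB s ε 1 0 r • v = x₃ at h ⊢
  generalize coeffB s ε 0 1 t • coeffB s ε 1 0 (r + 1) • v = x₄ at h ⊢
  rw [h]
  module

/-- `IsHighest.raise_lower` expresses the value at `t + 2` through values at `t` and `t + 1`, with
larger `r` allowed; for `t ≤ 0` the raising coefficient is zero. -/
theorem IsHighest.exists_raise_lower_eq (hv : IsHighest s ε μ v) (t r : ℤ) :
    ∃ c : ℂ, coeffB s ε 0 1 t • coeffB s ε 1 0 r • v = c • v := by
  have key : ∀ n : ℕ, ∀ t r : ℤ, t ≤ n →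
      ∃ c : ℂ, coeffB s ε 0 1 t • coeffB s ε 1 0 r • v = c • v := by
    intro n
    induction n with
    | zero =>
      intro t r ht
      refine ⟨0, ?_⟩
      rcases lt_or_eq_of_le ht with h | h
      · rw [coeffB_of_neg _ _ _ _ (by simpa using h), zero_smul, zero_smul]
      · rw [h, Nat.cast_zero, coeffB_zero, if_neg (by decide), zero_smul, zero_smul]
    | succ n ih =>
      intro t r ht
      obtain ⟨t, rfl⟩ : ∃ t', t = t' + 2 := ⟨t - 2, by ring⟩
      have h1 := hv.raise_lower t r
      obtain ⟨c₁, h₁⟩ := ih t (r + 2) (by push_cast at ht; omega)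
      obtain ⟨c₂, h₂⟩ := ih (t + 1) r (by push_cast at ht; omega)
      obtain ⟨c₃, h₃⟩ := ih t (r + 1) (by push_cast at ht; omega)
      rw [h₁, h₂, h₃, sub_eq_iff_eq_add, ← add_smul, ← sub_smul,
        smul_smul ((s 1 : ℤ) : ℂ), ← add_smul] at h1
      exact ⟨_, h1⟩
  exact key t.toNat t r (Int.self_le_toNat t)

/-- The right-hand side of the recurrence satisfied by the pairing of the lowering and raising
generators on a highest weight vector. -/
noncomputable def pairingSource (s : Fin 2 → ℤˣ) (μ : Fin 2 → ℂ⟦X⟧) (r : ℤ) : ℂ⸨X⸩ :=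
  ((s 1 : ℤ) : ℂ) •
    (((μ 0 : ℂ⸨X⸩).coeff r - (μ 1 : ℂ⸨X⸩).coeff r) • (u * (μ 0 : ℂ⸨X⸩))
      - ((μ 0 : ℂ⸨X⸩).coeff (r + 1) + (μ 1 : ℂ⸨X⸩).coeff (r + 1)) • (μ 0 : ℂ⸨X⸩)
      + (((μ 0 : ℂ⸨X⸩).coeff r - (μ 1 : ℂ⸨X⸩).coeff r) • (u * (μ 1 : ℂ⸨X⸩))
      + ((μ 0 : ℂ⸨X⸩).coeff (r + 1) + (μ 1 : ℂ⸨X⸩).coeff (r + 1)) • (μ 1 : ℂ⸨X⸩)))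

theorem IsHighest.exists_pairing (hv : IsHighest s ε μ v) (h0 : v ≠ 0) :
    ∃ c : ℤ → ℂ⟦X⟧,
      (∀ t r : ℤ, coeffB s ε 0 1 t • coeffB s ε 1 0 r • v = (c r : ℂ⸨X⸩).coeff t • v) ∧
      (∀ r ≤ 0, c r = 0) ∧
      ∀ r, u * (u * (c r : ℂ⸨X⸩)) - (c (r + 2) : ℂ⸨X⸩)
        - ((s 1 : ℤ) : ℂ) • (u * (c r : ℂ⸨X⸩)) + ((s 1 : ℤ) : ℂ) • (c (r + 1) : ℂ⸨X⸩) =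
          pairingSource s μ r := by
  choose d hd using hv.exists_raise_lower_eq
  have inj : ∀ {a b : ℂ}, a • v = b • v → a = b := fun h => smul_left_injective ℂ h0 h
  have hneg : ∀ t r : ℤ, t ≤ 0 → d t r = 0 := by
    intro t r ht
    apply inj
    rw [← hd, zero_smul]
    rcases lt_or_eq_of_le ht with h | h
    · rw [coeffB_of_neg _ _ _ _ h, zero_smul]
    · rw [h, coeffB_zero, if_neg (by decide), zero_smul]
  have hneg' : ∀ t r : ℤ, r ≤ 0 → d t r = 0 := by
    intro t r ht
    apply inj
    rw [← hd, zero_smul]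
    rcases lt_or_eq_of_le ht with h | h
    · rw [coeffB_of_neg _ _ 1 0 h, zero_smul, smul_zero]
    · rw [h, coeffB_zero _ _ 1 0, if_neg (by decide), zero_smul, smul_zero]
  have hc : ∀ t r : ℤ, ((PowerSeries.mk fun n : ℕ => d n r : ℂ⟦X⟧) : ℂ⸨X⸩).coeff t = d t r := by
    intro t r
    rcases lt_or_ge t 0 with h | h
    · rw [coeff_coe_of_neg _ h, hneg _ _ h.le]
    · lift t to ℕ using h
      rw [LaurentSeries.coeff_coe_powerSeries, PowerSeries.coeff_mk]
  refine ⟨fun r => PowerSeries.mk fun n : ℕ => d n r, fun t r => ?_, fun r hr => ?_, fun r => ?_⟩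
  · rw [hc, hd]
  · ext n
    rw [PowerSeries.coeff_mk, hneg' _ _ hr, map_zero]
  · ext t
    have h1 := hv.raise_lower t r
    simp only [hd, ← sub_smul, ← add_smul, smul_smul] at h1
    have h2 := inj h1
    simp only [pairingSource, HahnSeries.coeff_add, HahnSeries.coeff_sub, HahnSeries.coeff_smul,
      coeff_u_mul, hc, smul_eq_mul]
    rw [show t + 1 + 1 = t + 2 by ring]
    linear_combination h2

end Pairing

/-! ### Polynomials in `u` and the coefficients of the pairing -/

section Polynomials

theorem u_mul_X : u * ((PowerSeries.X : ℂ⟦X⟧) : ℂ⸨X⸩) = 1 := by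
  rw [u, HahnSeries.ofPowerSeries_X, HahnSeries.single_mul_single]
  simp

theorem u_ne_zero : u ≠ 0 := left_ne_zero_of_mul_eq_one u_mul_X

theorem coe_powerSeries_injective : Function.Injective fun f : ℂ⟦X⟧ => (f : ℂ⸨X⸩) :=
  HahnSeries.ofPowerSeries_injective

theorem coe_powerSeries_eq_zero {f : ℂ⟦X⟧} (h : (f : ℂ⸨X⸩) = 0) : f = 0 :=
  coe_powerSeries_injective (by simpa using h)

/-- Used to compare leading terms at `u = ∞`, with `n` free so that polynomials of different degrees
can be normalised by the same power. -/
theorem exists_aeval_u_eq (P : Polynomial ℂ) (n : ℕ) (hP : P.natDegree ≤ n) :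
    ∃ g : ℂ⟦X⟧, Polynomial.aeval u P = u ^ n * (g : ℂ⸨X⸩) ∧
      PowerSeries.constantCoeff g = P.coeff n := by
  refine Polynomial.induction_with_natDegree_le (fun P => ∃ g : ℂ⟦X⟧,
    Polynomial.aeval u P = u ^ n * (g : ℂ⸨X⸩) ∧ PowerSeries.constantCoeff g = P.coeff n) n
    ⟨0, by simp, by simp⟩ (fun k c hc hk => ?_) (fun f g df dg h1 h2 => ?_) P hP
  · obtain ⟨m, rfl⟩ := Nat.exists_eq_add_of_le hk
    refine ⟨PowerSeries.C c * PowerSeries.X ^ m, ?_, ?_⟩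
    · rw [map_mul, map_mul, map_pow, map_pow, Polynomial.aeval_C,
        LaurentSeries.algebraMap_apply, Polynomial.aeval_X, pow_add, HahnSeries.ofPowerSeries_C]
      have h : u ^ m * ((PowerSeries.X : ℂ⟦X⟧) : ℂ⸨X⸩) ^ m = 1 := by
        rw [← mul_pow, u_mul_X, one_pow]
      linear_combination (-(HahnSeries.C c : ℂ⸨X⸩) * u ^ k) * h
    · rw [Polynomial.coeff_C_mul, Polynomial.coeff_X_pow, map_mul, map_pow,
        PowerSeries.constantCoeff_C, PowerSeries.constantCoeff_X]
      rcases Nat.eq_zero_or_pos m with rfl | hm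
      · simp
      · rw [zero_pow hm.ne', if_neg (by omega)]
  · obtain ⟨a, ha, ha'⟩ := h1
    obtain ⟨b, hb, hb'⟩ := h2
    exact ⟨a + b, by rw [map_add, ha, hb, map_add, mul_add], by simp [ha', hb']⟩

theorem aeval_u_injective : Function.Injective (Polynomial.aeval (R := ℂ) u) := by
  rw [injective_iff_map_eq_zero]
  intro P hP
  obtain ⟨g, hg, hg'⟩ := exists_aeval_u_eq P _ le_rfl
  rw [hP, eq_comm, mul_eq_zero, or_iff_right (pow_ne_zero _ u_ne_zero)] at hg
  rw [coe_powerSeries_eq_zero hg, map_zero, eq_comm, Polynomial.coeff_natDegree,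
    Polynomial.leadingCoeff_eq_zero] at hg'
  exact hg'

theorem aeval_u_ne_zero {P : Polynomial ℂ} (hP : P ≠ 0) : Polynomial.aeval u P ≠ 0 := fun h =>
  hP (aeval_u_injective (h.trans (map_zero _).symm))

theorem natDegree_le_of_aeval_u_mul_eq {D e : Polynomial ℂ} {c m : ℂ⟦X⟧}
    (hm : PowerSeries.constantCoeff m ≠ 0)
    (h : Polynomial.aeval u D * (c : ℂ⸨X⸩) = Polynomial.aeval u e * (m : ℂ⸨X⸩)) :
    e.natDegree ≤ D.natDegree := by
  by_contra! hlt
  obtain ⟨g, hg, hg'⟩ := exists_aeval_u_eq e _ le_rfl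
  obtain ⟨g₂, hg₂, hg₂'⟩ := exists_aeval_u_eq D _ hlt.le
  rw [hg, hg₂, mul_assoc, mul_assoc] at h
  have h1 := mul_left_cancel₀ (pow_ne_zero _ u_ne_zero) h
  rw [← map_mul, ← map_mul] at h1
  have h2 := congrArg PowerSeries.constantCoeff (coe_powerSeries_injective h1)
  rw [map_mul, map_mul, hg₂', hg', Polynomial.coeff_eq_zero_of_natDegree_lt hlt, zero_mul,
    eq_comm, mul_eq_zero, or_iff_left hm, Polynomial.coeff_natDegree,
    Polynomial.leadingCoeff_eq_zero] at h2
  rw [h2] at hlt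
  simp at hlt

/-- The polynomial coefficients, at `μ_1(u)` for `η = -1` and at `μ_2(u)` for `η = 1`, of the
pairing of `b_{21}^{(r)}` with `b_{12}(u)` on a highest weight vector. -/
noncomputable def pairingPoly (s : Fin 2 → ℤˣ) (μ : Fin 2 → ℂ⟦X⟧) (η : ℂ) : ℕ → Polynomial ℂ
  | 0 => 0
  | 1 => Polynomial.C (-((s 1 : ℤ) : ℂ) * η *
      (PowerSeries.constantCoeff (μ 0) + PowerSeries.constantCoeff (μ 1)))
  | n + 2 => Polynomial.X ^ 2 * pairingPoly s μ η n
      - Polynomial.C ((s 1 : ℤ) : ℂ) * (Polynomial.X * pairingPoly s μ η n)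
      + Polynomial.C ((s 1 : ℤ) : ℂ) * pairingPoly s μ η (n + 1)
      - Polynomial.C ((s 1 : ℤ) : ℂ) *
        (Polynomial.C (PowerSeries.coeff n (μ 0) - PowerSeries.coeff n (μ 1)) * Polynomial.X
        + Polynomial.C (η * (PowerSeries.coeff (n + 1) (μ 0) + PowerSeries.coeff (n + 1) (μ 1))))

variable {s : Fin 2 → ℤˣ} {μ : Fin 2 → ℂ⟦X⟧}

theorem coeff_pairingPoly_of_le (η : ℂ) (n : ℕ) :
    ∀ k, n ≤ k → (pairingPoly s μ η n).coeff k = 0 := by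
  induction n using Nat.twoStepInduction with
  | zero => intro k _; simp [pairingPoly]
  | one => intro k hk; rw [pairingPoly, Polynomial.coeff_C, if_neg (by omega)]
  | more n ih1 ih2 =>
    intro k hk
    obtain ⟨k, rfl⟩ : ∃ k', k = k' + 2 := ⟨k - 2, by omega⟩
    rw [pairingPoly, Polynomial.coeff_sub, Polynomial.coeff_add, Polynomial.coeff_sub,
      Polynomial.coeff_X_pow_mul, Polynomial.coeff_C_mul, Polynomial.coeff_C_mul,
      Polynomial.coeff_C_mul, Polynomial.coeff_X_mul, ih1 _ (by omega), ih1 _ (by omega),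
      ih2 _ (by omega), Polynomial.coeff_add, Polynomial.coeff_C_mul, Polynomial.coeff_C,
      if_neg (by omega), Polynomial.coeff_X, if_neg (by omega)]
    ring

/-- Only the summand `X² p` of the recurrence reaches the top degree, so top coefficients depend
only on the parity of the index. -/
theorem coeff_pairingPoly_add_three (η : ℂ) (n : ℕ) :
    (pairingPoly s μ η (n + 3)).coeff (n + 2) = (pairingPoly s μ η (n + 1)).coeff n := by
  rw [pairingPoly, Polynomial.coeff_sub, Polynomial.coeff_add, Polynomial.coeff_sub,
      Polynomial.coeff_X_pow_mul, Polynomial.coeff_C_mul, Polynomial.coeff_C_mul,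
      Polynomial.coeff_C_mul, Polynomial.coeff_X_mul, coeff_pairingPoly_of_le η _ _ le_rfl,
      coeff_pairingPoly_of_le η _ _ le_rfl, Polynomial.coeff_add, Polynomial.coeff_C_mul,
      Polynomial.coeff_C, if_neg (by omega), Polynomial.coeff_X, if_neg (by omega)]
  ring

/-- The first two top coefficients are proportional to `ε_1 + ε_2` and `ε_1 - ε_2`, and these cannot
both vanish. -/
theorem exists_parity_coeff_pairingPoly_ne_zero {ε : Fin 2 → ℤˣ}
    (hμ : ∀ i, PowerSeries.constantCoeff (μ i) = ((ε i : ℤ) : ℂ)) {η : ℂ} (hη : η ≠ 0) :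
    ∃ i : ℕ, ∀ k : ℕ, (pairingPoly s μ η (2 * k + i + 1)).coeff (2 * k + i) ≠ 0 := by
  have step : ∀ i k : ℕ, (pairingPoly s μ η (2 * k + i + 1)).coeff (2 * k + i) =
      (pairingPoly s μ η (i + 1)).coeff i := by
    intro i k
    induction k with
    | zero => simp
    | succ k ih =>
      rw [← ih, show 2 * (k + 1) + i + 1 = 2 * k + i + 3 by ring,
        show 2 * (k + 1) + i = 2 * k + i + 2 by ring, coeff_pairingPoly_add_three]
  by_cases h : ε 0 = ε 1
  · refine ⟨0, fun k => ?_⟩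
    rw [step 0 k, zero_add, pairingPoly, Polynomial.coeff_C_zero, hμ, hμ, h, ← two_mul]
    exact mul_ne_zero (mul_ne_zero (neg_ne_zero.mpr (unit_cast_ne_zero _)) hη)
      (mul_ne_zero two_ne_zero (unit_cast_ne_zero _))
  · refine ⟨1, fun k => ?_⟩
    rw [step 1 k]
    have hs := unit_cast_ne_zero (s 1)
    have h2 : ((ε 0 : ℤ) : ℂ) - ((ε 1 : ℤ) : ℂ) ≠ 0 := by
      rw [sub_ne_zero]
      exact fun h' => h (Units.ext (Int.cast_injective h'))
    have h3 : (pairingPoly s μ η (1 + 1)).coeff 1 =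
        -(((s 1 : ℤ) : ℂ) * (((ε 0 : ℤ) : ℂ) - ((ε 1 : ℤ) : ℂ))) := by
      simp only [pairingPoly, PowerSeries.coeff_zero_eq_constantCoeff, hμ, mul_zero, sub_zero,
        Polynomial.coeff_sub, Polynomial.coeff_add, Polynomial.coeff_C_mul, Polynomial.coeff_X_one,
        Polynomial.coeff_C_succ, Polynomial.coeff_zero]
      ring
    rw [h3]
    exact neg_ne_zero.mpr (mul_ne_zero hs h2)

theorem pairing_eq {c : ℤ → ℂ⟦X⟧} (hc0 : ∀ r ≤ 0, c r = 0)
    (hc : ∀ r, u * (u * (c r : ℂ⸨X⸩)) - (c (r + 2) : ℂ⸨X⸩)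
        - ((s 1 : ℤ) : ℂ) • (u * (c r : ℂ⸨X⸩)) + ((s 1 : ℤ) : ℂ) • (c (r + 1) : ℂ⸨X⸩) =
          pairingSource s μ r) (n : ℕ) :
    (c n : ℂ⸨X⸩) = Polynomial.aeval u (pairingPoly s μ (-1) n) * (μ 0 : ℂ⸨X⸩) +
      Polynomial.aeval u (pairingPoly s μ 1 n) * (μ 1 : ℂ⸨X⸩) := by
  induction n using Nat.twoStepInduction with
  | zero => simp [pairingPoly, hc0]
  | one =>
    -- The recurrence at `-1` contains only `c 1`, and its source involves only the constant terms
    -- of the `μ_i`.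
    have h := hc (-1)
    rw [hc0 (-1) (by norm_num), show (-1 + 1 : ℤ) = 0 by norm_num, hc0 0 le_rfl,
      show (-1 + 2 : ℤ) = 1 by norm_num] at h
    rw [pairingSource, coeff_coe_of_neg _ (by norm_num), coeff_coe_of_neg _ (by norm_num),
      show (-1 + 1 : ℤ) = ((0 : ℕ) : ℤ) by norm_num, LaurentSeries.coeff_coe_powerSeries,
      LaurentSeries.coeff_coe_powerSeries, PowerSeries.coeff_zero_eq_constantCoeff] at h
    simp only [pairingPoly, ← HahnSeries.C_mul_eq_smul, map_zero, map_mul, map_add, map_sub, map_neg,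
      map_one,
      Polynomial.aeval_C, LaurentSeries.algebraMap_apply, Nat.cast_one] at h ⊢
    linear_combination -h
  | more n ih1 ih2 =>
    have h := hc n
    rw [pairingSource, ← Nat.cast_succ n, LaurentSeries.coeff_coe_powerSeries,
      LaurentSeries.coeff_coe_powerSeries, LaurentSeries.coeff_coe_powerSeries,
      LaurentSeries.coeff_coe_powerSeries, ih1, Nat.succ_eq_add_one, ih2] at h
    simp only [pairingPoly, ← HahnSeries.C_mul_eq_smul, map_mul, map_add, map_sub, map_neg,
      map_one, map_pow, Polynomial.aeval_C,
      LaurentSeries.algebraMap_apply, Polynomial.aeval_X] at h ⊢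
    push_cast
    linear_combination -h

end Polynomials

/-! ### The functional equation under `u ↦ s_2 - u` and its solution -/

section FunctionalEquation

variable {s : Fin 2 → ℤˣ} {μ : Fin 2 → ℂ⟦X⟧}

/-- The numerator of the pairing when `μ_1(u) / μ_2(u) = C(u) / D(u)`. -/
noncomputable def pairingNum (s : Fin 2 → ℤˣ) (μ : Fin 2 → ℂ⟦X⟧) (D C : Polynomial ℂ) (n : ℕ) :
    Polynomial ℂ :=
  pairingPoly s μ (-1) n * C + pairingPoly s μ 1 n * D

theorem aeval_mul_pairing {c : ℤ → ℂ⟦X⟧}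
    (hc : ∀ n : ℕ, (c n : ℂ⸨X⸩) = Polynomial.aeval u (pairingPoly s μ (-1) n) * (μ 0 : ℂ⸨X⸩) +
      Polynomial.aeval u (pairingPoly s μ 1 n) * (μ 1 : ℂ⸨X⸩))
    {D C : Polynomial ℂ}
    (hDC : Polynomial.aeval u D * (μ 0 : ℂ⸨X⸩) = Polynomial.aeval u C * (μ 1 : ℂ⸨X⸩)) (n : ℕ) :
    Polynomial.aeval u D * (c n : ℂ⸨X⸩) =
      Polynomial.aeval u (pairingNum s μ D C n) * (μ 1 : ℂ⸨X⸩) := by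
  rw [hc, pairingNum, map_add, map_mul, map_mul]
  linear_combination Polynomial.aeval u (pairingPoly s μ (-1) n) * hDC

/-- Stated for all integers, so that it can be read as an identity of Laurent coefficients. `toNat`
sends negative indices to `0`, where the numerator vanishes. -/
theorem pairingNum_recurrence (D C : Polynomial ℂ) (r : ℤ) :
    Polynomial.X ^ 2 * pairingNum s μ D C r.toNat
      - Polynomial.C ((s 1 : ℤ) : ℂ) * (Polynomial.X ^ 1 * pairingNum s μ D C r.toNat)
      - pairingNum s μ D C (r + 1 + 1).toNat
      + Polynomial.C ((s 1 : ℤ) : ℂ) * pairingNum s μ D C (r + 1).toNat =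
    Polynomial.C ((s 1 : ℤ) : ℂ) *
      (Polynomial.C ((μ 0 : ℂ⸨X⸩).coeff r - (μ 1 : ℂ⸨X⸩).coeff r) * (Polynomial.X ^ 1 * (C + D))
        + Polynomial.C ((μ 0 : ℂ⸨X⸩).coeff (r + 1) + (μ 1 : ℂ⸨X⸩).coeff (r + 1)) * (D - C)) := by
  rcases lt_or_ge r 0 with hr | hr
  · rw [coeff_coe_of_neg _ hr, coeff_coe_of_neg _ hr, Int.toNat_of_nonpos hr.le,
      Int.toNat_of_nonpos (by omega : r + 1 ≤ 0)]
    rcases lt_or_ge (r + 1) 0 with h1 | h1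
    · rw [coeff_coe_of_neg _ h1, coeff_coe_of_neg _ h1,
        Int.toNat_of_nonpos (by omega : r + 1 + 1 ≤ 0)]
      simp [pairingNum, pairingPoly]
    · obtain rfl : r = -1 := by omega
      rw [show (-1 + 1 : ℤ) = ((0 : ℕ) : ℤ) by norm_num, LaurentSeries.coeff_coe_powerSeries,
        LaurentSeries.coeff_coe_powerSeries, PowerSeries.coeff_zero_eq_constantCoeff,
        show (((0 : ℕ) : ℤ) + 1).toNat = 1 by norm_num]
      simp only [pairingNum, pairingPoly, map_sub, map_add, map_mul, map_neg, map_one, map_zero]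
      ring
  · lift r to ℕ using hr
    rw [show ((r : ℤ) + 1 + 1).toNat = r + 2 by omega, show ((r : ℤ) + 1).toNat = r + 1 by omega,
      Int.toNat_natCast, ← Nat.cast_succ, LaurentSeries.coeff_coe_powerSeries,
      LaurentSeries.coeff_coe_powerSeries, LaurentSeries.coeff_coe_powerSeries,
      LaurentSeries.coeff_coe_powerSeries]
    simp only [pairingNum, pairingPoly, map_sub, map_add, map_mul, map_neg, map_one]
    ring

/-- The kernel method: the generating function of the numerators is multiplied by `(X - u)(X + u -
s_2)` in the summed recurrence, and `X = s_2 - u` annihilates that factor. The degree bound makes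
the substitution legitimate. -/
theorem reflection_identity {D C : Polynomial ℂ} {d : ℕ}
    (hd : ∀ n, (pairingNum s μ D C n).natDegree ≤ d) :
    Polynomial.aeval (((s 1 : ℤ) : ℂ⸨X⸩) - u) C *
        ((2 * u - ((s 1 : ℤ) : ℂ⸨X⸩)) * (μ 0 : ℂ⸨X⸩) + ((s 1 : ℤ) : ℂ⸨X⸩) * (μ 1 : ℂ⸨X⸩)) =
      Polynomial.aeval (((s 1 : ℤ) : ℂ⸨X⸩) - u) D *
        (((s 1 : ℤ) : ℂ⸨X⸩) * (μ 0 : ℂ⸨X⸩) + (2 * u - ((s 1 : ℤ) : ℂ⸨X⸩)) * (μ 1 : ℂ⸨X⸩)) := by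
  -- `g k` collects the coefficients of `X^k` over all numerators, weighted by `u^{-n}`, so `G = ∑
  -- g_k X^k`. Shifting `n` becomes multiplication by `u`.
  set g : ℕ → ℂ⸨X⸩ := fun k =>
    ((PowerSeries.mk fun n => (pairingNum s μ D C n).coeff k : ℂ⟦X⟧) : ℂ⸨X⸩) with hg
  have hgc : ∀ (k : ℕ) (t : ℤ), (g k).coeff t = (pairingNum s μ D C t.toNat).coeff k := by
    intro k t
    rcases lt_or_ge t 0 with ht | ht
    · rw [hg, coeff_coe_of_neg _ ht, Int.toNat_of_nonpos ht.le]
      simp [pairingNum, pairingPoly]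
    · lift t to ℕ using ht
      simp only [hg]
      rw [LaurentSeries.coeff_coe_powerSeries, PowerSeries.coeff_mk, Int.toNat_natCast]
  set G : Polynomial ℂ⸨X⸩ := ∑ k ∈ Finset.range (d + 1), Polynomial.monomial k (g k) with hG
  have hGk : ∀ k, G.coeff k = g k := by
    intro k
    rw [hG, Polynomial.finsetSum_coeff]
    simp only [Polynomial.coeff_monomial, Finset.sum_ite_eq', Finset.mem_range]
    split_ifs with h
    · rfl
    · ext t
      rw [hgc, Polynomial.coeff_eq_zero_of_natDegree_lt ((hd _).trans_lt (by omega))]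
      rfl
  set σ : ℂ⸨X⸩ := HahnSeries.C ((s 1 : ℤ) : ℂ) with hσ
  have hσ' : ((s 1 : ℤ) : ℂ⸨X⸩) = σ := by rw [hσ, map_intCast]
  have key : Polynomial.X ^ 2 * G - Polynomial.C σ * (Polynomial.X ^ 1 * G)
      - Polynomial.C u * (Polynomial.C u * G) + Polynomial.C σ * (Polynomial.C u * G) =
      Polynomial.C σ *
        ((Polynomial.X ^ 1 * (C + D).map (algebraMap ℂ ℂ⸨X⸩)) *
          Polynomial.C ((μ 0 : ℂ⸨X⸩) - (μ 1 : ℂ⸨X⸩))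
        + (D - C).map (algebraMap ℂ ℂ⸨X⸩) *
          Polynomial.C (u * ((μ 0 : ℂ⸨X⸩) + (μ 1 : ℂ⸨X⸩)))) := by
    ext k t
    have h := congrArg (fun p => Polynomial.coeff p k)
      (pairingNum_recurrence (s := s) (μ := μ) D C t)
    have hC : ∀ (x : ℂ⸨X⸩) (z : ℂ), (HahnSeries.C z * x).coeff t = z * x.coeff t := fun x z => by
      rw [HahnSeries.C_mul_eq_smul, HahnSeries.coeff_smul, smul_eq_mul]
    simp only [Polynomial.coeff_add, Polynomial.coeff_sub, Polynomial.coeff_C_mul,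
      Polynomial.coeff_mul_C, Polynomial.coeff_X_pow_mul', hGk, Polynomial.coeff_map,
      LaurentSeries.algebraMap_apply, hσ] at h ⊢
    rcases Nat.lt_or_ge k 1 with h1 | h1
    · have h2 : ¬ 2 ≤ k := by omega
      simp only [if_neg (not_le.mpr h1), if_neg h2, HahnSeries.coeff_add, HahnSeries.coeff_sub,
        hC, coeff_u_mul, hgc, mul_zero, zero_mul, HahnSeries.coeff_zero] at h ⊢
      linear_combination h
    rcases Nat.lt_or_ge k 2 with h2 | h2
    · simp only [if_pos h1, if_neg (not_le.mpr h2), HahnSeries.coeff_add, HahnSeries.coeff_sub,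
        hC, coeff_u_mul, hgc, HahnSeries.coeff_zero] at h ⊢
      linear_combination h
    · simp only [if_pos h1, if_pos h2, HahnSeries.coeff_add, HahnSeries.coeff_sub,
        hC, coeff_u_mul, hgc] at h ⊢
      linear_combination h
  have h := congrArg (Polynomial.eval (σ - u)) key
  simp only [Polynomial.eval_add, Polynomial.eval_sub, Polynomial.eval_mul, Polynomial.eval_pow,
    Polynomial.eval_X, Polynomial.eval_C, Polynomial.map_add, Polynomial.map_sub,
    Polynomial.eval_map_algebraMap] at h
  have hs : σ ≠ 0 := by
    rw [hσ]
    exact (map_ne_zero _).mpr (unit_cast_ne_zero _)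
  rw [hσ']
  apply mul_left_cancel₀ hs
  linear_combination h

/-- Divide out the gcd. Coprimality makes `A'` divide `B' ∘ τ` and conversely, so they are
associated, and `P` is `A'` made monic. -/
theorem exists_monic_of_mul_comp_eq {A B τ : Polynomial ℂ} (hA : A ≠ 0)
    (hτ : τ.comp τ = Polynomial.X) (h : A * A.comp τ = B * B.comp τ) :
    ∃ (P : Polynomial ℂ) (k : ℂ), P.Monic ∧
      A * P.comp τ = Polynomial.C k * (B * P) := by
  classical
  have hinv : ∀ p : Polynomial ℂ, (p.comp τ).comp τ = p := fun p => by
    rw [Polynomial.comp_assoc, hτ, Polynomial.comp_X]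
  have hcomp : ∀ {p : Polynomial ℂ}, p ≠ 0 → p.comp τ ≠ 0 := by
    intro p hp h0
    apply hp
    rw [← hinv p, h0, Polynomial.zero_comp]
  set g := EuclideanDomain.gcd A B with hg
  have hg0 : g ≠ 0 := fun h0 => hA (EuclideanDomain.gcd_eq_zero_iff.mp h0).1
  obtain ⟨A', hA'⟩ := EuclideanDomain.gcd_dvd_left A B
  obtain ⟨B', hB'⟩ := EuclideanDomain.gcd_dvd_right A B
  rw [← hg] at hA' hB'
  have hco : IsCoprime A' B' := by
    have h1 := EuclideanDomain.gcd_eq_gcd_ab A B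
    rw [← hg] at h1
    refine ⟨EuclideanDomain.gcdA A B, EuclideanDomain.gcdB A B, mul_left_cancel₀ hg0 ?_⟩
    linear_combination -h1 - EuclideanDomain.gcdA A B * hA' - EuclideanDomain.gcdB A B * hB'
  have h' : A' * A'.comp τ = B' * B'.comp τ := by
    apply mul_left_cancel₀ (mul_ne_zero hg0 (hcomp hg0))
    rw [hA', hB', Polynomial.mul_comp, Polynomial.mul_comp] at h
    linear_combination h
  have hA0 : A' ≠ 0 := fun h0 => hA (by rw [hA', h0, mul_zero])
  have hco' : IsCoprime (A'.comp τ) (B'.comp τ) := hco.map (Polynomial.compRingHom τ)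
  have d1 : A' ∣ B'.comp τ := hco.dvd_of_dvd_mul_left (h' ▸ dvd_mul_right _ _)
  have d2 : B'.comp τ ∣ A' := hco'.symm.dvd_of_dvd_mul_right (h' ▸ dvd_mul_left _ _)
  obtain ⟨w, hw⟩ := associated_of_dvd_dvd d1 d2
  obtain ⟨k, hk, hk'⟩ := Polynomial.isUnit_iff.mp w.isUnit
  rw [← hk'] at hw
  have hB : B' = A'.comp τ * Polynomial.C k := by
    rw [← hinv B', ← hw, Polynomial.mul_comp, Polynomial.C_comp]
  refine ⟨A' * Polynomial.C A'.leadingCoeff⁻¹, k⁻¹,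
    Polynomial.monic_mul_leadingCoeff_inv hA0, ?_⟩
  have hkk : Polynomial.C k⁻¹ * Polynomial.C k = 1 := by
    rw [← Polynomial.C_mul, inv_mul_cancel₀ hk.ne_zero, Polynomial.C_1]
  rw [Polynomial.mul_comp, Polynomial.C_comp, hA', hB', hB]
  linear_combination (-g * A'.comp τ * A' * Polynomial.C A'.leadingCoeff⁻¹) * hkk

theorem muTilde_zero : muTilde s μ 0 =
    (2 * u - ((s 1 : ℤ) : ℂ⸨X⸩)) * (μ 0 : ℂ⸨X⸩) + ((s 1 : ℤ) : ℂ⸨X⸩) * (μ 1 : ℂ⸨X⸩) := by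
  have h : Finset.Ioi (0 : Fin 2) = {1} := by decide
  rw [muTilde, rhoSucc, h, Finset.sum_singleton, Finset.sum_singleton]

theorem muTilde_one : muTilde s μ 1 = 2 * u * (μ 1 : ℂ⸨X⸩) := by
  have h : Finset.Ioi (1 : Fin 2) = ∅ := by decide
  rw [muTilde, rhoSucc, h, Finset.sum_empty, Finset.sum_empty, sub_zero, add_zero]

theorem aeval_reflect (P : Polynomial ℂ) :
    Polynomial.aeval (-u + ((s 1 : ℤ) : ℂ⸨X⸩)) P =
      Polynomial.aeval u (P.comp (Polynomial.C ((s 1 : ℤ) : ℂ) - Polynomial.X)) := by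
  rw [Polynomial.aeval_comp, map_sub, Polynomial.aeval_C, Polynomial.aeval_X,
    LaurentSeries.algebraMap_apply, map_intCast, sub_eq_neg_add]

/-- If `μ_1(u) / μ_2(u)` is rational, the ratio of the modified weights is a multiple of
`P(u) / P(s_2 - u)` for some monic polynomial `P`. -/
theorem exists_monic_of_rational {D C : Polynomial ℂ} (hD : D ≠ 0) {d : ℕ} (hμ1 : μ 1 ≠ 0)
    (hμ0 : muTilde s μ 0 ≠ 0)
    (hDC : Polynomial.aeval u D * (μ 0 : ℂ⸨X⸩) = Polynomial.aeval u C * (μ 1 : ℂ⸨X⸩))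
    (hd : ∀ n, (pairingNum s μ D C n).natDegree ≤ d) :
    ∃ (P : Polynomial ℂ) (k : ℂ), P.Monic ∧
      muTilde s μ 0 * Polynomial.aeval (-u + ((s 1 : ℤ) : ℂ⸨X⸩)) P =
        HahnSeries.C k * (muTilde s μ 1 * Polynomial.aeval u P) := by
  have hm : (μ 1 : ℂ⸨X⸩) ≠ 0 := fun h => hμ1 (coe_powerSeries_eq_zero h)
  have hDu := aeval_u_ne_zero hD
  set t : ℂ := ((s 1 : ℤ) : ℂ) with ht
  set A : Polynomial ℂ := (2 * Polynomial.X - Polynomial.C t) * C + Polynomial.C t * D with hA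
  set B : Polynomial ℂ := 2 * Polynomial.X * D with hB
  set τ : Polynomial ℂ := Polynomial.C t - Polynomial.X with hτ
  have hAu : Polynomial.aeval u A = (2 * u - ((s 1 : ℤ) : ℂ⸨X⸩)) * Polynomial.aeval u C +
      ((s 1 : ℤ) : ℂ⸨X⸩) * Polynomial.aeval u D := by
    simp only [hA, ht, map_add, map_mul, map_sub, Polynomial.aeval_X, map_intCast, map_ofNat]
  have hBu : Polynomial.aeval u B = 2 * u * Polynomial.aeval u D := by
    simp only [hB, map_mul, Polynomial.aeval_X, map_ofNat]
  have h0 : Polynomial.aeval u D * muTilde s μ 0 = Polynomial.aeval u A * (μ 1 : ℂ⸨X⸩) := by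
    rw [muTilde_zero, hAu]
    linear_combination (2 * u - ((s 1 : ℤ) : ℂ⸨X⸩)) * hDC
  have h1 : Polynomial.aeval u D * muTilde s μ 1 = Polynomial.aeval u B * (μ 1 : ℂ⸨X⸩) := by
    rw [muTilde_one, hBu]; ring
  have hA0 : A ≠ 0 := by
    intro h
    rw [h, map_zero, zero_mul] at h0
    exact mul_ne_zero hDu hμ0 h0
  have href := reflection_identity hd
  have hy : ∀ P : Polynomial ℂ, Polynomial.aeval u (P.comp τ) =
      Polynomial.aeval (((s 1 : ℤ) : ℂ⸨X⸩) - u) P := fun P => by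
    rw [sub_eq_neg_add, aeval_reflect]
  have hcross : Polynomial.aeval (((s 1 : ℤ) : ℂ⸨X⸩) - u) C * Polynomial.aeval u A =
      Polynomial.aeval (((s 1 : ℤ) : ℂ⸨X⸩) - u) D *
        (((s 1 : ℤ) : ℂ⸨X⸩) * Polynomial.aeval u C +
          (2 * u - ((s 1 : ℤ) : ℂ⸨X⸩)) * Polynomial.aeval u D) := by
    apply mul_right_cancel₀ hm
    rw [hAu]
    linear_combination Polynomial.aeval u D * href
      + (-(2 * u - ((s 1 : ℤ) : ℂ⸨X⸩)) * Polynomial.aeval (((s 1 : ℤ) : ℂ⸨X⸩) - u) C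
        + ((s 1 : ℤ) : ℂ⸨X⸩) * Polynomial.aeval (((s 1 : ℤ) : ℂ⸨X⸩) - u) D) * hDC
  -- Multiply `hcross` by `t - 2u`: the mixed terms cancel, and `t² - (2u - t)² = 4u(t - u)`
  -- produces the factors of `B`.
  have hAB : A * A.comp τ = B * B.comp τ := by
    apply aeval_u_injective
    have e1 : Polynomial.aeval u (A.comp τ) = (((s 1 : ℤ) : ℂ⸨X⸩) - 2 * u) *
        Polynomial.aeval (((s 1 : ℤ) : ℂ⸨X⸩) - u) C +
        ((s 1 : ℤ) : ℂ⸨X⸩) * Polynomial.aeval (((s 1 : ℤ) : ℂ⸨X⸩) - u) D := by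
      rw [hy]
      simp only [hA, ht, map_add, map_mul, map_sub, Polynomial.aeval_X, map_intCast, map_ofNat]
      ring
    have e2 : Polynomial.aeval u (B.comp τ) = 2 * (((s 1 : ℤ) : ℂ⸨X⸩) - u) *
        Polynomial.aeval (((s 1 : ℤ) : ℂ⸨X⸩) - u) D := by
      rw [hy]
      simp only [hB, map_mul, Polynomial.aeval_X, map_ofNat]
    rw [map_mul, map_mul, e1, e2, hBu]
    rw [hAu] at hcross ⊢
    linear_combination (((s 1 : ℤ) : ℂ⸨X⸩) - 2 * u) * hcross
  have hττ : τ.comp τ = Polynomial.X := by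
    rw [hτ, Polynomial.sub_comp, Polynomial.C_comp, Polynomial.X_comp]; ring
  obtain ⟨P, k, hP, hPk⟩ := exists_monic_of_mul_comp_eq hA0 hττ hAB
  refine ⟨P, k, hP, ?_⟩
  apply mul_left_cancel₀ hDu
  have hPu := congrArg (Polynomial.aeval u) hPk
  rw [map_mul, map_mul, map_mul, Polynomial.aeval_C, LaurentSeries.algebraMap_apply] at hPu
  rw [aeval_reflect]
  linear_combination (Polynomial.aeval u (P.comp τ)) * h0 + (μ 1 : ℂ⸨X⸩) * hPu
    - HahnSeries.C k * Polynomial.aeval u P * h1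

end FunctionalEquation

/-! ### Linear relations among the vectors `b_{21}^{(r)} v` -/

section Combinations

variable {s ε : Fin 2 → ℤˣ} {μ : Fin 2 → ℂ⟦X⟧}

theorem IsHighest.map {N N' : Type*} [AddCommGroup N] [Module ℂ N] [Module (Yangian s ε) N]
    [IsScalarTower ℂ (Yangian s ε) N] [AddCommGroup N'] [Module ℂ N'] [Module (Yangian s ε) N']
    [IsScalarTower ℂ (Yangian s ε) N'] {v : N} (hv : IsHighest s ε μ v)
    (f : N →ₗ[Yangian s ε] N') : IsHighest s ε μ (f v) where
  raise r := by rw [← map_smul, hv.raise, map_zero]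
  diag i r := by rw [← map_smul, hv.diag, LinearMap.map_smul_of_tower]

theorem raise_linearCombination {N : Type*} [AddCommGroup N] [Module ℂ N] [Module (Yangian s ε) N]
    [IsScalarTower ℂ (Yangian s ε) N] {v : N} {c : ℤ → ℂ⟦X⟧}
    (hc : ∀ t r : ℤ, coeffB s ε 0 1 t • coeffB s ε 1 0 r • v = (c r : ℂ⸨X⸩).coeff t • v)
    {ι : Type*} (n : ι → ℕ) (a : ι →₀ ℂ) (t : ℤ) :
    coeffB s ε 0 1 t • Finsupp.linearCombination ℂ (fun k => coeffB s ε 1 0 (n k : ℤ) • v) a =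
      ((Finsupp.linearCombination ℂ (fun k => c (n k)) a : ℂ⟦X⟧) : ℂ⸨X⸩).coeff t • v := by
  induction a using Finsupp.induction_linear with
  | zero => simp
  | add f g hf hg =>
    rw [map_add, smul_add, hf, hg, map_add, map_add, HahnSeries.coeff_add, add_smul]
  | single k z =>
    rw [Finsupp.linearCombination_single, Finsupp.linearCombination_single, smul_comm_complex, hc,
      PowerSeries.smul_eq_C_mul, map_mul, HahnSeries.ofPowerSeries_C, HahnSeries.C_mul_eq_smul,
      HahnSeries.coeff_smul, smul_assoc]

theorem cartan_linearCombination {N : Type*} [AddCommGroup N] [Module ℂ N] [Module (Yangian s ε) N]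
    [IsScalarTower ℂ (Yangian s ε) N] {v : N} (hv : IsHighest s ε μ v)
    {ι : Type*} (n : ι → ℕ) (a : ι →₀ ℂ) :
    coeffB s ε 0 0 1 • Finsupp.linearCombination ℂ (fun k => coeffB s ε 1 0 (n k : ℤ) • v) a =
      ((μ 0 : ℂ⸨X⸩).coeff 1 + weightStep s ε) •
        Finsupp.linearCombination ℂ (fun k => coeffB s ε 1 0 (n k : ℤ) • v) a := by
  induction a using Finsupp.induction_linear with
  | zero => simp
  | add f g hf hg => rw [map_add, smul_add, hf, hg, smul_add]
  | single k z =>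
    rw [Finsupp.linearCombination_single, smul_comm_complex, smul_smul (coeffB s ε 0 0 1),
      cartan_mul_coeffB, add_smul, mul_smul, hv.diag, smul_comm_complex, smul_assoc, ← add_smul,
      smul_comm z]
    simp

/-- A combination of the vectors `b_{21}^{(r)} v` vanishes in the irreducible quotient if and only
if it is annihilated by `b_{12}(u)`. -/
theorem linearCombination_mem_maxSubmodule [Nontrivial (Verma s ε μ)] {c : ℤ → ℂ⟦X⟧}
    (hc : ∀ t r : ℤ, coeffB s ε 0 1 t • coeffB s ε 1 0 r • vermaVec s ε μ =
      (c r : ℂ⸨X⸩).coeff t • vermaVec s ε μ) {ι : Type*} (n : ι → ℕ) (a : ι →₀ ℂ) :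
    Finsupp.linearCombination ℂ (fun k => coeffB s ε 1 0 (n k : ℤ) • vermaVec s ε μ) a ∈
        maxSubmodule s ε μ ↔ Finsupp.linearCombination ℂ (fun k => c (n k)) a = 0 := by
  constructor
  · intro h
    ext t
    -- A nonzero coefficient of the combined series would put the highest weight vector into the
    -- maximal submodule.
    have h1 := (maxSubmodule s ε μ).smul_mem (coeffB s ε 0 1 t) h
    rw [raise_linearCombination hc, LaurentSeries.coeff_coe_powerSeries] at h1
    by_contra h2
    rw [map_zero] at h2
    refine vermaVec_not_mem_maxSubmodule (s := s) (ε := ε) (μ := μ) ?_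
    have h3 := (maxSubmodule s ε μ).smul_of_tower_mem
      (PowerSeries.coeff t (Finsupp.linearCombination ℂ (fun k => c (n k)) a))⁻¹ h1
    rwa [smul_smul, inv_mul_cancel₀ h2, one_smul] at h3
  · intro h
    refine mem_maxSubmodule_of_singular
      (cartan_linearCombination (isHighest_vermaVec s ε μ) n a) fun r => ?_
    rw [raise_linearCombination hc, h, map_zero, HahnSeries.coeff_zero]
    exact zero_smul ℂ (vermaVec s ε μ)

/-- If the irreducible quotient is finite-dimensional, then `μ_1(u) / μ_2(u)` is rational. -/
theorem exists_rational_of_finiteDimensional [Nontrivial (Verma s ε μ)]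
    (hμ : ∀ i, PowerSeries.constantCoeff (μ i) = ((ε i : ℤ) : ℂ)) {c : ℤ → ℂ⟦X⟧}
    (hc : ∀ t r : ℤ, coeffB s ε 0 1 t • coeffB s ε 1 0 r • vermaVec s ε μ =
      (c r : ℂ⸨X⸩).coeff t • vermaVec s ε μ)
    (hcp : ∀ n : ℕ, (c n : ℂ⸨X⸩) = Polynomial.aeval u (pairingPoly s μ (-1) n) * (μ 0 : ℂ⸨X⸩) +
      Polynomial.aeval u (pairingPoly s μ 1 n) * (μ 1 : ℂ⸨X⸩))
    (hfin : FiniteDimensional ℂ (Irr s ε μ)) :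
    ∃ D C : Polynomial ℂ, D ≠ 0 ∧
      Polynomial.aeval u D * (μ 0 : ℂ⸨X⸩) = Polynomial.aeval u C * (μ 1 : ℂ⸨X⸩) := by
  obtain ⟨i, hi⟩ := exists_parity_coeff_pairingPoly_ne_zero (s := s) hμ
    (η := -1) (by norm_num)
  -- Only indices of the parity with nonvanishing top coefficient are used, so the polynomials in
  -- front of `μ_1` have distinct degrees and `D` cannot cancel to zero.
  set n : ℕ → ℕ := fun k => 2 * k + i + 1 with hn
  have hdep : ¬ LinearIndependent ℂ (fun k : ℕ =>
      (maxSubmodule s ε μ).mkQ (coeffB s ε 1 0 (n k : ℤ) • vermaVec s ε μ)) := fun h => by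
    have := h.finite
    exact not_finite ℕ
  rw [linearIndependent_iff] at hdep
  push Not at hdep
  obtain ⟨a, ha, ha0⟩ := hdep
  have h1 : Finsupp.linearCombination ℂ (fun k => c (n k)) a = 0 := by
    rw [← linearCombination_mem_maxSubmodule hc, ← Submodule.ker_mkQ (maxSubmodule s ε μ),
      LinearMap.mem_ker, ← ha, Finsupp.linearCombination_apply, Finsupp.linearCombination_apply,
      Finsupp.sum, Finsupp.sum, map_sum]
    exact Finset.sum_congr rfl fun k _ => LinearMap.map_smul_of_tower _ _ _
  have h2 : Polynomial.aeval u (∑ k ∈ a.support, Polynomial.C (a k) * pairingPoly s μ (-1) (n k))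
        * (μ 0 : ℂ⸨X⸩) +
      Polynomial.aeval u (∑ k ∈ a.support, Polynomial.C (a k) * pairingPoly s μ 1 (n k))
        * (μ 1 : ℂ⸨X⸩) = 0 := by
    have h3 := congrArg (fun f : ℂ⟦X⟧ => (f : ℂ⸨X⸩)) h1
    simp only [Finsupp.linearCombination_apply, Finsupp.sum, map_sum, map_zero,
      PowerSeries.smul_eq_C_mul, map_mul, HahnSeries.ofPowerSeries_C, hcp] at h3
    simp only [map_sum, map_mul, Polynomial.aeval_C, LaurentSeries.algebraMap_apply,
      Finset.sum_mul, ← Finset.sum_add_distrib]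
    rw [← h3]
    exact Finset.sum_congr rfl fun k _ => by ring
  refine ⟨∑ k ∈ a.support, Polynomial.C (a k) * pairingPoly s μ (-1) (n k),
    -∑ k ∈ a.support, Polynomial.C (a k) * pairingPoly s μ 1 (n k), fun h0 => ?_, by
      rw [map_neg]; linear_combination h2⟩
  have hne : a.support.Nonempty := Finsupp.support_nonempty_iff.mpr ha0
  set K := a.support.max' hne with hK
  have hKm : K ∈ a.support := Finset.max'_mem _ _
  have h4 := congrArg (fun p => Polynomial.coeff p (2 * K + i)) h0
  simp only [Polynomial.finsetSum_coeff, Polynomial.coeff_C_mul, Polynomial.coeff_zero] at h4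
  rw [Finset.sum_eq_single_of_mem K hKm] at h4
  · exact mul_ne_zero (Finsupp.mem_support_iff.mp hKm) (hi K) h4
  · intro k hk hkK
    have := Finset.le_max' _ _ hk
    rw [coeff_pairingPoly_of_le _ _ _ (by simp only [hn]; omega), mul_zero]

end Combinations

/-! ### Finite spanning sets from the oddness of `b_{21}` -/

section Finiteness

/-- A sequence of polynomials of bounded degree is eventually in the span of its earlier terms. -/
theorem exists_eventually_mem_span {e : ℕ → Polynomial ℂ} {d : ℕ}
    (he : ∀ n, (e n).natDegree ≤ d) :
    ∃ R, ∀ t, R ≤ t → ∃ a : ℕ → ℂ, ∑ r ∈ Finset.range t, a r • e r = e t := by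
  set e' : ℕ → Polynomial.degreeLT ℂ (d + 1) := fun n => ⟨e n, Polynomial.mem_degreeLT.mpr
    (Polynomial.degree_lt_iff_coeff_zero _ _ |>.mpr fun m hm =>
      Polynomial.coeff_eq_zero_of_natDegree_lt ((he n).trans_lt hm))⟩ with he'
  have hfin : Module.Finite ℂ (Polynomial.degreeLT ℂ (d + 1)) :=
    Module.Finite.equiv (Polynomial.degreeLTEquiv ℂ (d + 1)).symm
  obtain ⟨R, hR⟩ := monotone_stabilizes_iff_noetherian.mpr
    (inferInstance : IsNoetherian ℂ (Polynomial.degreeLT ℂ (d + 1)))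
    ⟨fun t => Submodule.span ℂ (e' '' (Finset.range t : Set ℕ)), fun t t' h =>
      Submodule.span_mono (Set.image_mono (by simpa using Set.Iio_subset_Iio h))⟩
  refine ⟨R, fun t ht => ?_⟩
  have h1 : e' t ∈ Submodule.span ℂ (e' '' (Finset.range t : Set ℕ)) := by
    have h2 := (hR (t + 1) (by omega)).symm.trans (hR t ht)
    have h3 : e' t ∈ Submodule.span ℂ (e' '' (Finset.range (t + 1) : Set ℕ)) :=
      Submodule.subset_span ⟨t, by simp, rfl⟩
    exact (SetLike.ext_iff.mp h2 _).mp h3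
  obtain ⟨a, ha⟩ := (Submodule.mem_span_image_finset_iff_exists_fun ℂ).mp h1
  refine ⟨fun r => if h : r ∈ Finset.range t then a ⟨r, h⟩ else 0, ?_⟩
  rw [← Finset.sum_coe_sort]
  have := congrArg Subtype.val ha
  simpa [he'] using this

variable {s ε : Fin 2 → ℤˣ} {μ : Fin 2 → ℂ⟦X⟧} {N : Type*} [AddCommGroup N] [Module ℂ N]
  [Module (Yangian s ε) N] [IsScalarTower ℂ (Yangian s ε) N] {v : N}

theorem commSign_lower (hs : s 0 ≠ s 1) : commSign s 1 0 1 0 = -1 := by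
  rcases Int.units_eq_one_or (s 0) with h | h <;>
    rcases Int.units_eq_one_or (s 1) with h' | h' <;> simp_all [commSign, parity]

/-- As `s_1 ≠ s_2`, the element is odd and its supercommutator with itself is twice its square. -/
theorem lower_mul_self_mem_filt (hs : s 0 ≠ s 1) (r : ℤ) :
    coeffB s ε 1 0 r * coeffB s ε 1 0 r ∈ filt s ε (r + r - 1) 2 := by
  have h := sComm_mem_filt (s := s) (ε := ε) 1 0 1 0 r r
  have h1 : (-1 : ℂ) • (coeffB s ε 1 0 r * coeffB s ε 1 0 r) =
      -(coeffB s ε 1 0 r * coeffB s ε 1 0 r) :=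
    neg_one_smul ℂ (coeffB s ε 1 0 r * coeffB s ε 1 0 r)
  rw [sComm, commSign_lower hs, h1, sub_neg_eq_add,
    ← two_smul ℂ (coeffB s ε 1 0 r * coeffB s ε 1 0 r)] at h
  have h2 := Submodule.smul_mem _ (2 : ℂ)⁻¹ h
  rw [smul_smul, inv_mul_cancel₀ two_ne_zero, one_smul] at h2
  exact h2

/-- If almost all `b_{21}^{(r)} v` are combinations of earlier ones, then the module generated
by the highest weight vector `v` lies in a finite-dimensional space. -/
theorem IsHighest.exists_finiteDimensional (hs : s 0 ≠ s 1) (hv : IsHighest s ε μ v) {R : ℕ}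
    (hR : ∀ t, R ≤ t → ∃ a : ℕ → ℂ,
      ∑ r ∈ Finset.range t, a r • coeffB s ε 1 0 (r : ℤ) • v = coeffB s ε 1 0 (t : ℤ) • v) :
    ∃ T : Submodule ℂ N, FiniteDimensional ℂ T ∧ ∀ x : Yangian s ε, x • v ∈ T := by
  set letter : Fin R → Fin 2 × Fin 2 × ℕ := fun m => (1, 0, (m : ℕ)) with hletter
  set S : Set N := Set.range fun l : {l : List (Fin R) // l.Nodup} =>
    word s ε (l.1.map letter) • v with hS
  refine ⟨Submodule.span ℂ S, FiniteDimensional.span_of_finite ℂ (Set.finite_range _),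
    smul_mem_of_word_smul_mem _ v fun l => word_smul_mem _ v (wordWt l) (fun l hl H => ?_) l rfl⟩
  rw [← hl] at H
  by_cases h1 : ∀ x ∈ l, x.1 = 1 ∧ x.2.1 = 0
  swap
  · push Not at h1
    obtain ⟨x, hx, hx'⟩ := h1
    exact hv.exists_perm_word_smul_mem _ hx (fun h => hx' h.1 h.2) H
  -- A letter with large index is moved next to `v` and replaced by letters of smaller index, which
  -- lowers the degree.
  by_cases h2 : ∀ x ∈ l, x.2.2 < R
  swap
  · push Not at h2
    obtain ⟨⟨i, j, m⟩, hx, hx'⟩ := h2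
    obtain ⟨rfl, rfl⟩ : i = 1 ∧ j = 0 := h1 _ hx
    obtain ⟨l', hl'⟩ := exists_perm_append_singleton hx
    refine ⟨_, hl', ?_⟩
    obtain ⟨a, ha⟩ := hR (m + 1) (by simp only at hx'; omega)
    rw [word_append_singleton_smul]
    simp only
    rw [← Nat.cast_succ, Nat.succ_eq_add_one, ← ha, Finset.smul_sum]
    refine sum_mem fun r hr => ?_
    rw [smul_comm_complex, smul_smul (word s ε l')]
    refine Submodule.smul_mem _ _ (H _ ?_)
    rw [wordDeg_perm hl', wordWt_perm hl', wordDeg_append, wordWt_append, wordDeg_cons,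
      wordWt_cons, wordDeg_nil, wordWt_nil, add_zero]
    have := Finset.mem_range.mp hr
    have h3 := mul_mem_filt (word_mem_filt (s := s) (ε := ε) l' le_rfl rfl)
      (coeffB_mem_filt (s := s) (ε := ε) 1 0 (r : ℤ))
    have h4 : wordDeg l' + (r : ℤ) ≤ wordDeg l' + ((m : ℤ) + 1) - 1 := by omega
    exact filt_mono h4 h3
  by_cases h3 : l.Nodup
  · obtain ⟨l', rfl⟩ : l ∈ Set.range (List.map letter) := by
      rw [Set.range_list_map]
      exact fun x hx => ⟨⟨x.2.2, h2 x hx⟩, Prod.ext (h1 x hx).1.symm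
        (Prod.ext (h1 x hx).2.symm rfl)⟩
    refine ⟨l'.map letter, List.Perm.refl _, Submodule.subset_span ?_⟩
    rw [hS, Set.mem_range]
    exact ⟨⟨l', h3.of_map _⟩, rfl⟩
  -- A repeated letter is brought together into a square at the front, and that square has lower
  -- degree.
  · rw [← List.exists_duplicate_iff_not_nodup] at h3
    obtain ⟨x, hx⟩ := h3
    have hxl := h1 x hx.mem
    obtain ⟨l', hl'⟩ := (List.duplicate_iff_sublist.mp hx).exists_perm_append
    refine ⟨_, hl', H _ ?_⟩
    rw [wordDeg_perm hl', wordWt_perm hl', word_append, word_cons, word_cons, word_nil, mul_one,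
      wordDeg_append, wordWt_append, hxl.1, hxl.2]
    refine filt_mono ?_ ((?_ : (2 : ℤ) + wordWt l' = _) ▸
      mul_mem_filt (lower_mul_self_mem_filt hs _) (word_mem_filt l' le_rfl rfl))
    · simp
    · simp [hxl.1, hxl.2]

end Finiteness

/-! ### Rationality suffices, and the constant in the ratio -/

section Classification

variable {s ε : Fin 2 → ℤˣ} {μ : Fin 2 → ℂ⟦X⟧}

/-- If `μ_1(u) / μ_2(u)` is rational, then the irreducible quotient is finite-dimensional. -/
theorem finiteDimensional_of_rational (hs : s 0 ≠ s 1) [Nontrivial (Verma s ε μ)]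
    (hμ : PowerSeries.constantCoeff (μ 1) ≠ 0) {c : ℤ → ℂ⟦X⟧}
    (hc : ∀ t r : ℤ, coeffB s ε 0 1 t • coeffB s ε 1 0 r • vermaVec s ε μ =
      (c r : ℂ⸨X⸩).coeff t • vermaVec s ε μ)
    (hcp : ∀ n : ℕ, (c n : ℂ⸨X⸩) = Polynomial.aeval u (pairingPoly s μ (-1) n) * (μ 0 : ℂ⸨X⸩) +
      Polynomial.aeval u (pairingPoly s μ 1 n) * (μ 1 : ℂ⸨X⸩))
    {D C : Polynomial ℂ} (hD : D ≠ 0)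
    (hDC : Polynomial.aeval u D * (μ 0 : ℂ⸨X⸩) = Polynomial.aeval u C * (μ 1 : ℂ⸨X⸩)) :
    FiniteDimensional ℂ (Irr s ε μ) := by
  have hnum := aeval_mul_pairing hcp hDC
  -- The numerators have degree at most `deg D`. Linear relations among them transfer to the series
  -- `c_r`, and then to the vectors in the irreducible quotient.
  obtain ⟨R, hR⟩ := exists_eventually_mem_span fun n => natDegree_le_of_aeval_u_mul_eq hμ (hnum n)
  have hv : IsHighest s ε μ ((maxSubmodule s ε μ).mkQ (vermaVec s ε μ)) :=
    (isHighest_vermaVec s ε μ).map _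
  obtain ⟨T, hT, hxT⟩ := hv.exists_finiteDimensional hs (R := R) fun t ht => by
    obtain ⟨a, ha⟩ := hR t ht
    refine ⟨a, ?_⟩
    have h1 : ∑ r ∈ Finset.range t, a r • c r = c t := by
      apply coe_powerSeries_injective
      apply mul_left_cancel₀ (aeval_u_ne_zero hD)
      simp only [map_sum, PowerSeries.smul_eq_C_mul, map_mul, HahnSeries.ofPowerSeries_C, hnum]
      rw [← ha, Finset.mul_sum, map_sum, Finset.sum_mul]
      refine Finset.sum_congr rfl fun r _ => ?_
      rw [mul_left_comm, hnum, Polynomial.smul_eq_C_mul, map_mul, Polynomial.aeval_C,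
        LaurentSeries.algebraMap_apply, mul_assoc]
    have h2 := (linearCombination_mem_maxSubmodule hc id
      (∑ r ∈ Finset.range t, Finsupp.single r (a r) - Finsupp.single t 1)).mpr (by
        rw [map_sub, map_sum, Finsupp.linearCombination_single, one_smul, sub_eq_zero, id, ← h1]
        simp only [Finsupp.linearCombination_single, id])
    rw [← Submodule.ker_mkQ (maxSubmodule s ε μ), LinearMap.mem_ker, map_sub, map_sub,
      sub_eq_zero, Finsupp.linearCombination_single, map_sum, map_sum] at h2
    have h3 : (maxSubmodule s ε μ).mkQ
        ((1 : ℂ) • coeffB s ε 1 0 (id t : ℕ) • vermaVec s ε μ) =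
        coeffB s ε 1 0 (t : ℤ) • (maxSubmodule s ε μ).mkQ (vermaVec s ε μ) := by
      rw [LinearMap.map_smul_of_tower, map_smul]
      exact one_smul ℂ (coeffB s ε 1 0 (t : ℤ) • (maxSubmodule s ε μ).mkQ (vermaVec s ε μ))
    rw [← h3, ← h2]
    refine Finset.sum_congr rfl fun r _ => ?_
    rw [Finsupp.linearCombination_single, LinearMap.map_smul_of_tower, map_smul]
    rfl
  have hTtop : T = ⊤ := by
    rw [eq_top_iff]
    rintro y -
    obtain ⟨z, rfl⟩ := (maxSubmodule s ε μ).mkQ_surjective y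
    obtain ⟨x, rfl⟩ := exists_smul_vermaVec s ε μ z
    rw [map_smul]
    exact hxT x
  rw [hTtop] at hT
  exact Module.finite_def.mpr (Module.Finite.iff_fg.mp hT)

theorem u_mul_coe_X_mul (f : ℂ⟦X⟧) : u * ((PowerSeries.X * f : ℂ⟦X⟧) : ℂ⸨X⸩) = (f : ℂ⸨X⸩) := by
  rw [map_mul, ← mul_assoc, u_mul_X, one_mul]

theorem exists_muTilde_zero_eq (hμ : ∀ i, PowerSeries.constantCoeff (μ i) = ((ε i : ℤ) : ℂ)) :
    ∃ m : ℂ⟦X⟧, muTilde s μ 0 = u * (m : ℂ⸨X⸩) ∧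
      PowerSeries.constantCoeff m = 2 * ((ε 0 : ℤ) : ℂ) := by
  refine ⟨2 * μ 0 - PowerSeries.X * (((s 1 : ℤ) : ℂ⟦X⟧) * μ 0)
    + PowerSeries.X * (((s 1 : ℤ) : ℂ⟦X⟧) * μ 1), ?_, ?_⟩
  · rw [muTilde_zero, map_add, map_sub, mul_add, mul_sub, u_mul_coe_X_mul, u_mul_coe_X_mul]
    simp only [map_mul, map_intCast, map_ofNat]
    ring
  · simp [hμ]
    exact map_ofNat _ 2

theorem exists_muTilde_one_eq (hμ : ∀ i, PowerSeries.constantCoeff (μ i) = ((ε i : ℤ) : ℂ)) :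
    ∃ m : ℂ⟦X⟧, muTilde s μ 1 = u * (m : ℂ⸨X⸩) ∧
      PowerSeries.constantCoeff m = 2 * ((ε 1 : ℤ) : ℂ) := by
  refine ⟨2 * μ 1, ?_, ?_⟩
  · rw [muTilde_one]
    simp only [map_mul, map_ofNat]
    ring
  · simp [hμ]
    exact map_ofNat _ 2

theorem u_mul_coe_ne_zero {m : ℂ⟦X⟧} (hm : PowerSeries.constantCoeff m ≠ 0) :
    u * (m : ℂ⸨X⸩) ≠ 0 := by
  refine mul_ne_zero u_ne_zero fun h => hm ?_
  rw [coe_powerSeries_eq_zero h, map_zero]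

theorem two_mul_unit_ne_zero (e : ℤˣ) : 2 * ((e : ℤ) : ℂ) ≠ 0 :=
  mul_ne_zero two_ne_zero (unit_cast_ne_zero e)

theorem natDegree_reflect (z : ℂ) (P : Polynomial ℂ) :
    (P.comp (Polynomial.C z - Polynomial.X)).natDegree = P.natDegree := by
  rw [Polynomial.natDegree_comp, Polynomial.natDegree_sub_eq_right_of_natDegree_lt (by simp),
    Polynomial.natDegree_X, mul_one]

theorem coeff_reflect (z : ℂ) {P : Polynomial ℂ} (hP : P.Monic) :
    (P.comp (Polynomial.C z - Polynomial.X)).coeff P.natDegree = (-1) ^ P.natDegree := by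
  have h1 : (Polynomial.C z - Polynomial.X).natDegree = 1 := by
    rw [Polynomial.natDegree_sub_eq_right_of_natDegree_lt (by simp), Polynomial.natDegree_X]
  have h2 : (Polynomial.C z - Polynomial.X).leadingCoeff = -1 := by
    rw [Polynomial.leadingCoeff, h1]; simp
  have h3 := Polynomial.leadingCoeff_comp (p := P) (q := Polynomial.C z - Polynomial.X)
    (by rw [h1]; exact one_ne_zero)
  rw [Polynomial.leadingCoeff, natDegree_reflect, h2, hP.leadingCoeff, one_mul] at h3
  exact h3

/-- The constant in front of `P(u) / P(s_2 - u)` is determined by the leading terms. -/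
theorem const_eq_of_muTilde_mul_eq
    (hμ : ∀ i, PowerSeries.constantCoeff (μ i) = ((ε i : ℤ) : ℂ)) {P : Polynomial ℂ}
    (hP : P.Monic) {k : ℂ}
    (h : muTilde s μ 0 * Polynomial.aeval (-u + ((s 1 : ℤ) : ℂ⸨X⸩)) P =
        HahnSeries.C k * (muTilde s μ 1 * Polynomial.aeval u P)) :
    k = ((ε 0 : ℤ) : ℂ) * ((ε 1 : ℤ) : ℂ) * (-1) ^ P.natDegree := by
  obtain ⟨m₀, h₀, h₀'⟩ := exists_muTilde_zero_eq (s := s) hμ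
  obtain ⟨m₁, h₁, h₁'⟩ := exists_muTilde_one_eq (s := s) hμ
  obtain ⟨g, hg, hg'⟩ := exists_aeval_u_eq P _ le_rfl
  obtain ⟨g₂, hg₂, hg₂'⟩ := exists_aeval_u_eq
    (P.comp (Polynomial.C ((s 1 : ℤ) : ℂ) - Polynomial.X)) P.natDegree (natDegree_reflect _ _).le
  rw [coeff_reflect _ hP] at hg₂'
  rw [hP.coeff_natDegree] at hg'
  rw [aeval_reflect, h₀, h₁, hg, hg₂, ← HahnSeries.ofPowerSeries_C] at h
  have h2 : m₀ * g₂ = PowerSeries.C k * (m₁ * g) := by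
    apply coe_powerSeries_injective
    apply mul_left_cancel₀ (mul_ne_zero u_ne_zero (pow_ne_zero P.natDegree u_ne_zero))
    simp only [map_mul]
    linear_combination h
  have h3 := congrArg PowerSeries.constantCoeff h2
  rw [map_mul, map_mul, map_mul, h₀', h₁', hg', hg₂', PowerSeries.constantCoeff_C] at h3
  have h4 := unit_cast_mul_self (ε 1)
  linear_combination (-((ε 1 : ℤ) : ℂ) / 2) * h3 - k * h4

end Classification

end TwistedSuperYangian

theorem mainTheorem5
    (s ε : Fin 2 → ℤˣ) (hs : s 0 ≠ s 1)
    (μ : Fin 2 → PowerSeries ℂ)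
    (hμ : ∀ i, PowerSeries.constantCoeff (μ i) = ((ε i : ℤ) : ℂ))
    (hM : Nontrivial (TwistedSuperYangian.Verma s ε μ)) :
    FiniteDimensional ℂ (TwistedSuperYangian.Irr s ε μ) ↔
      ∃ P : Polynomial ℂ, P.Monic ∧
        TwistedSuperYangian.muTilde s μ 0 / TwistedSuperYangian.muTilde s μ 1 =
          ((ε 0 : ℤ) : LaurentSeries ℂ) * ((ε 1 : ℤ) : LaurentSeries ℂ)
            * (-1) ^ P.natDegree *
            (Polynomial.aeval TwistedSuperYangian.u P /
              Polynomial.aeval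
                (-TwistedSuperYangian.u + ((s 1 : ℤ) : LaurentSeries ℂ)) P) := by
  open TwistedSuperYangian in
  obtain ⟨c, hc, hc0, hrec⟩ := (isHighest_vermaVec s ε μ).exists_pairing vermaVec_ne_zero
  have hcp := pairing_eq hc0 hrec
  have hμ1 : PowerSeries.constantCoeff (μ 1) ≠ 0 := hμ 1 ▸ unit_cast_ne_zero _
  obtain ⟨m₀, h₀, h₀'⟩ := exists_muTilde_zero_eq (s := s) hμ
  obtain ⟨m₁, h₁, h₁'⟩ := exists_muTilde_one_eq (s := s) hμ
  have hm₀ : muTilde s μ 0 ≠ 0 := h₀ ▸ u_mul_coe_ne_zero (h₀' ▸ two_mul_unit_ne_zero _)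
  have hm₁ : muTilde s μ 1 ≠ 0 := h₁ ▸ u_mul_coe_ne_zero (h₁' ▸ two_mul_unit_ne_zero _)
  have hrefl : ∀ P : Polynomial ℂ, P.Monic →
      Polynomial.aeval (-u + ((s 1 : ℤ) : LaurentSeries ℂ)) P ≠ 0 := fun P hP => by
    rw [aeval_reflect]
    refine aeval_u_ne_zero fun h => ?_
    have h1 := coeff_reflect ((s 1 : ℤ) : ℂ) hP
    rw [h, Polynomial.coeff_zero] at h1
    exact pow_ne_zero _ (by norm_num) h1.symm
  constructor
  · intro hfin
    obtain ⟨D, C, hD, hDC⟩ := exists_rational_of_finiteDimensional hμ hc hcp hfin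
    obtain ⟨P, k, hP, hk⟩ := exists_monic_of_rational hD
      (fun h => hμ1 (by rw [h, map_zero])) hm₀ hDC fun n =>
        natDegree_le_of_aeval_u_mul_eq hμ1 (aeval_mul_pairing hcp hDC n)
    refine ⟨P, hP, ?_⟩
    have hk' := const_eq_of_muTilde_mul_eq hμ hP hk
    rw [hk', map_mul, map_mul, map_pow, map_neg, map_one, map_intCast, map_intCast] at hk
    rw [← mul_div_assoc, div_eq_div_iff hm₁ (hrefl P hP)]
    linear_combination hk
  · rintro ⟨P, hP, h⟩
    rw [← mul_div_assoc, div_eq_div_iff hm₁ (hrefl P hP), aeval_reflect, muTilde_zero,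
      muTilde_one] at h
    -- Solving the hypothesis for `μ_1/μ_2` gives the fraction `C/D` below.
    set Q := P.comp (Polynomial.C ((s 1 : ℤ) : ℂ) - Polynomial.X) with hQ
    refine finiteDimensional_of_rational hs hμ1 hc hcp
      (D := (2 * Polynomial.X - Polynomial.C ((s 1 : ℤ) : ℂ)) * Q)
      (C := 2 * Polynomial.C (((ε 0 : ℤ) : ℂ) * ((ε 1 : ℤ) : ℂ) * (-1) ^ P.natDegree)
        * (Polynomial.X * P) - Polynomial.C ((s 1 : ℤ) : ℂ) * Q) (mul_ne_zero ?_ ?_) ?_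
    · intro h0
      have := congrArg (Polynomial.coeff · 1) h0
      simp only [Polynomial.coeff_sub, Polynomial.coeff_ofNat_mul, Polynomial.coeff_X_one,
        Polynomial.coeff_C_succ, Polynomial.coeff_zero, mul_one, sub_zero] at this
      exact two_ne_zero this
    · intro h0
      apply hrefl P hP
      rw [aeval_reflect, ← hQ, h0, map_zero]
    · simp only [map_mul, map_sub, Polynomial.aeval_X, map_ofNat, map_pow, map_neg, map_one,
        map_intCast]
      linear_combination h
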